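/- **Theorem 2.7 (Endothermic energies derived from thermal diffusion).** Let $\Omega\subset\mathbb R^3$ be a bounded domain with smooth boundary and unit outer normal $n_\Omega$, and let $T>0$. For $0\le t<T$ let $\Omega_A(t)$ be a bounded domain with $\overline{\Omega_A(t)}\subset\Omega$ whose boundary $\Gamma(t)=\partial\Omega_A(t)$ is a smooth closed surface, with unit normal $n_\Gamma$ pointing out of $\Omega_A(t)$; put $\Omega_B(t)=\Omega\setminus\overline{\Omega_A(t)}$. Write $\nabla_\Gamma f=\nabla f-n_\Gamma(n_\Gamma\cdot\nabla)f$ with components $\partial_i^\Gamma f$, $\mathrm{div}_\Gamma V=\sum_{i=1}^3\partial^\Gamma_iV_i$, and let $\mathcal H^2$ be the 2-dimensional Hausdorff measure, normalized to be the surface area. Let $\theta_A,\theta_B,\theta_S$ (temperatures) and $\kappa_A,\kappa_B,\kappa_S$ (conductivities) be real-valued smooth functions of $(x,t)\in\mathbb R^4$, and assume that for $0<t<T$ $$(n_\Omega\cdot\nabla)\theta_B=0\ \text{ on }\partial\Omega,\qquad \theta_A=\theta_B=\theta_S\ \text{ on }\Gamma(t).$$ Fix $t\in(0,T)$ and let $$E_{TD}[\vartheta_A,\vartheta_B,\vartheta_S]=-\int_{\Omega_A(t)}\frac{\kappa_A}{2}|\nabla\vartheta_A|^2\,dx-\int_{\Omega_B(t)}\frac{\kappa_B}{2}|\nabla\vartheta_B|^2\,dx-\int_{\Gamma(t)}\frac{\kappa_S}{2}|\nabla_\Gamma\vartheta_S|^2\,d\mathcal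 H^2_x .$$ Let $Q_A,Q_B,Q_S\in C(\mathbb R^3)$ and suppose that for all $\psi_A,\psi_B,\psi_S\in C^\infty(\mathbb R^3)$ with $(n_\Omega\cdot\nabla)\psi_B=0$ on $\partial\Omega$ and $\psi_A=\psi_B=\psi_S$ on $\Gamma(t)$, $$\frac{d}{d\varepsilon}\bigg|_{\varepsilon=0}E_{TD}[\theta_A+\varepsilon\psi_A,\theta_B+\varepsilon\psi_B,\theta_S+\varepsilon\psi_S]=\int_{\Omega_A(t)}Q_A\psi_A\,dx+\int_{\Omega_B(t)}Q_B\psi_B\,dx+\int_{\Gamma(t)}Q_S\psi_S\,d\mathcal H^2_x .$$ Then, at time $t$, $$Q_A=\mathrm{div}(\kappa_A\nabla\theta_A)\ \text{ in }\Omega_A(t),\qquad Q_B=\mathrm{div}(\kappa_B\nabla\theta_B)\ \text{ in }\Omega_B(t),$$ $$Q_S=\mathrm{div}_\Gamma(\kappa_S\nabla_\Gamma\theta_S)+\kappa_B(n_\Gamma\cdot\nabla)\theta_B-\kappa_A(n_\Gamma\cdot\nabla)\theta_A\ \text{ on }\Gamma(t).$$ -/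

import Mathlib

open MeasureTheory Set Filter Topology
open scoped ContDiff InnerProductSpace

noncomputable section

namespace ThermalDiffusion

/-- Three-dimensional Euclidean space. -/
abbrev E3 := EuclideanSpace ℝ (Fin 3)

/-- `ρ` is a smooth local defining function of the set `D` at the point `p`:
near `p`, the set `D` is `{ρ < 0}`, and `∇ρ (p) ≠ 0`. -/
structure IsDefiningFunctionAt (D : Set E3) (p : E3) (ρ : E3 → ℝ) : Prop where
  smooth : ContDiff ℝ ∞ ρ
  gradient_ne_zero : gradient ρ p ≠ 0
  mem_iff : ∀ᶠ x in 𝓝 p, (x ∈ D ↔ ρ x < 0)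

/-- A bounded domain (a nonempty connected open set) of three-dimensional space with smooth
boundary: every boundary point has a smooth local defining function.  In particular the boundary
`frontier D` is a compact smooth embedded surface without boundary. -/
structure IsBoundedSmoothDomain (D : Set E3) : Prop where
  isOpen : IsOpen D
  isConnected : IsConnected D
  isBounded : Bornology.IsBounded D
  smooth_boundary : ∀ p ∈ frontier D, ∃ ρ : E3 → ℝ, IsDefiningFunctionAt D p ρ

open Classical in
/-- The unit outer normal vector `n = ∇ρ / |∇ρ|` of `D` at a boundary point `p`, where `ρ` is any
local defining function of `D` at `p` (see `outerNormal_eq` for the independence of `ρ`). -/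
def outerNormal (D : Set E3) (p : E3) : E3 :=
  if h : ∃ ρ : E3 → ℝ, IsDefiningFunctionAt D p ρ then
    ‖gradient h.choose p‖⁻¹ • gradient h.choose p
  else 0

/-- The orthogonal projection `P = I - n ⊗ n` along the vector field `n`, at the point `x`. -/
def tangentProj (n : E3 → E3) (x v : E3) : E3 := v - ⟪n x, v⟫_ℝ • n x

/-- The surface gradient `∇_Γ f = P ∇ f = ∇ f - n (n · ∇) f` of a function `f` on space,
where `n` is a unit normal of the surface. -/
def surfGrad (n : E3 → E3) (f : E3 → ℝ) (x : E3) : E3 := tangentProj n x (gradient f x)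

/-- The divergence `∑ i, ∂ᵢ Vᵢ` of a vector field on space. -/
def divergence (V : E3 → E3) (x : E3) : ℝ :=
  ∑ i : Fin 3, (fderiv ℝ V x (EuclideanSpace.single i 1)) i

/-- The surface divergence `∑ i, ∂ᵢ^Γ Vᵢ`, with `∂ᵢ^Γ = ∂ᵢ - nᵢ (n · ∇)`, of a vector field given
on the surface `Γ` with unit normal `n`.  As `n` and therefore the fields of interest are only
given on `Γ`, the derivative is the one within `Γ`; it is evaluated only in the tangential
directions `P eᵢ`, on which it is determined by `V` on `Γ`.
(see `surfDiv_eq` for a field with a differentiable extension). -/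
def surfDiv (Γ : Set E3) (n : E3 → E3) (V : E3 → E3) (x : E3) : ℝ :=
  ∑ i : Fin 3, (fderivWithin ℝ V Γ x (tangentProj n x (EuclideanSpace.single i 1))) i

/-- The energy dissipation due to thermal diffusion
`E_TD = ∫_{Ω_A} (- κ_A/2 |∇θ_A|²) dx + ∫_{Ω_B} (- κ_B/2 |∇θ_B|²) dx
  + ∫_Γ (- κ_S/2 |∇_Γ θ_S|²) dℋ²`,
where `Γ = ∂Ω_A`.  Here `μHE[2]` is the two-dimensional Hausdorff measure in its usual
normalization, for which it is the area of surfaces. -/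
def thermalEnergy (ΩA ΩB : Set E3) (κA κB κS θA θB θS : E3 → ℝ) : ℝ :=
  (∫ x in ΩA, -(κA x / 2) * ‖gradient θA x‖ ^ 2)
    + (∫ x in ΩB, -(κB x / 2) * ‖gradient θB x‖ ^ 2)
    + ∫ x in frontier ΩA, -(κS x / 2) * ‖surfGrad (outerNormal ΩA) θS x‖ ^ 2 ∂μHE[2]

/-- The restrictions on temperatures `(θ_A, θ_B, θ_S)` (or on their variations) at a fixed time:
`(n_Ω · ∇) θ_B = 0` on `∂Ω` and `θ_A = θ_B = θ_S` on `Γ = ∂Ω_A`. -/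
def ThermalBoundaryConditions (Ω ΩA : Set E3) (θA θB θS : E3 → ℝ) : Prop :=
  (∀ x ∈ frontier Ω, ⟪outerNormal Ω x, gradient θB x⟫_ℝ = 0) ∧
    ∀ x ∈ frontier ΩA, θA x = θB x ∧ θB x = θS x

/-! ### The normal and the surface divergence are well defined -/

lemma IsDefiningFunctionAt.hasDerivAt_line {D : Set E3} {p : E3} {ρ : E3 → ℝ}
    (h : IsDefiningFunctionAt D p ρ) (v : E3) :
    HasDerivAt (fun s : ℝ => ρ (p + s • v)) ⟪gradient ρ p, v⟫_ℝ 0 := by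
  have hd : DifferentiableAt ℝ ρ (p + (0 : ℝ) • v) := by
    simpa using (h.smooth.differentiable (by simp)) p
  have hl : HasDerivAt (fun s : ℝ => p + s • v) v 0 := by
    simpa using ((hasDerivAt_id (0 : ℝ)).smul_const v).const_add p
  have := hd.hasFDerivAt.comp_hasDerivAt (0 : ℝ) hl
  simpa [gradient, Function.comp_def] using this

lemma IsDefiningFunctionAt.eq_zero {D : Set E3} {p : E3} {ρ : E3 → ℝ}
    (h : IsDefiningFunctionAt D p ρ) (hD : IsOpen D) (hp : p ∈ frontier D) : ρ p = 0 := by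
  have hp' : p ∈ closure D \ D := by rwa [hD.frontier_eq] at hp
  apply le_antisymm
  · by_contra hpos
    have h1 : ∀ᶠ x in 𝓝 p, 0 < ρ x :=
      h.smooth.continuous.continuousAt.eventually (lt_mem_nhds (not_le.mp hpos))
    obtain ⟨x, hx, hx1, hx2⟩ :=
      ((mem_closure_iff_frequently.mp hp'.1).and_eventually (h1.and h.mem_iff)).exists
    exact absurd (hx2.mp hx) (not_lt.mpr hx1.le)
  · exact not_lt.mp fun hn => hp'.2 (h.mem_iff.self_of_nhds.mpr hn)

lemma tendsto_line (p v : E3) : Tendsto (fun s : ℝ => p + s • v) (𝓝[>] 0) (𝓝 p) := by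
  have : Continuous fun s : ℝ => p + s • v := by fun_prop
  simpa using (this.tendsto 0).mono_left nhdsWithin_le_nhds

/-- Directions in which a defining function decreases point into `D`. -/
lemma IsDefiningFunctionAt.eventually_mem {D : Set E3} {p : E3} {ρ : E3 → ℝ}
    (h : IsDefiningFunctionAt D p ρ) (h0 : ρ p = 0) {v : E3} (hv : ⟪gradient ρ p, v⟫_ℝ < 0) :
    ∀ᶠ s : ℝ in 𝓝[>] 0, p + s • v ∈ D := by
  have ht := (hasDerivAt_iff_tendsto_slope.mp (h.hasDerivAt_line v)).mono_left
    (nhdsWithin_mono (0 : ℝ) (fun s (hs : s ∈ Ioi (0 : ℝ)) => ne_of_gt hs))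
  filter_upwards [ht.eventually (gt_mem_nhds hv), self_mem_nhdsWithin,
    (tendsto_line p v).eventually h.mem_iff] with s h1 hs h2
  rw [h2]
  have hs' : (0 : ℝ) < s := hs
  simp only [slope_def_field, zero_smul, add_zero, h0, sub_zero] at h1
  exact (div_neg_iff.mp h1).elim (fun h => absurd h.2 (not_lt.mpr hs'.le)) (·.1)

/-- Directions in which a defining function increases point out of `D`. -/
lemma IsDefiningFunctionAt.eventually_notMem {D : Set E3} {p : E3} {ρ : E3 → ℝ}
    (h : IsDefiningFunctionAt D p ρ) (h0 : ρ p = 0) {v : E3} (hv : 0 < ⟪gradient ρ p, v⟫_ℝ) :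
    ∀ᶠ s : ℝ in 𝓝[>] 0, p + s • v ∉ D := by
  have ht := (hasDerivAt_iff_tendsto_slope.mp (h.hasDerivAt_line v)).mono_left
    (nhdsWithin_mono (0 : ℝ) (fun s (hs : s ∈ Ioi (0 : ℝ)) => ne_of_gt hs))
  filter_upwards [ht.eventually (lt_mem_nhds hv), self_mem_nhdsWithin,
    (tendsto_line p v).eventually h.mem_iff] with s h1 hs h2
  rw [h2, not_lt]
  have hs' : (0 : ℝ) < s := hs
  simp only [slope_def_field, zero_smul, add_zero, h0, sub_zero] at h1
  exact ((div_pos_iff_of_pos_right hs').mp h1).le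

/-- The unit outer normal does not depend on the defining function. -/
theorem outerNormal_eq {D : Set E3} (hD : IsOpen D) {p : E3} (hp : p ∈ frontier D) {ρ : E3 → ℝ}
    (h : IsDefiningFunctionAt D p ρ) :
    outerNormal D p = ‖gradient ρ p‖⁻¹ • gradient ρ p := by
  have hex : ∃ ρ : E3 → ℝ, IsDefiningFunctionAt D p ρ := ⟨ρ, h⟩
  rw [outerNormal, dif_pos hex]
  have h' := hex.choose_spec
  set σ := hex.choose
  set a := gradient σ p with ha
  set b := gradient ρ p with hb
  have ha0 : 0 < ‖a‖ := norm_pos_iff.mpr h'.gradient_ne_zero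
  have hb0 : 0 < ‖b‖ := norm_pos_iff.mpr h.gradient_ne_zero
  have key : ∀ v : E3, ⟪a, v⟫_ℝ < 0 → ⟪b, v⟫_ℝ ≤ 0 := by
    intro v hv
    by_contra hbv
    obtain ⟨s, h1, h2⟩ := ((h'.eventually_mem (h'.eq_zero hD hp) hv).and
      (h.eventually_notMem (h.eq_zero hD hp) (not_le.mp hbv))).exists
    exact h2 h1
  -- test with a direction between the two normals
  have hab : ‖a‖ * ‖b‖ ≤ ⟪a, b⟫_ℝ := by
    by_contra hlt
    rw [not_le] at hlt
    have := key (‖a‖ • b - ‖b‖ • a) (by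
      rw [inner_sub_right, real_inner_smul_right, real_inner_smul_right,
        real_inner_self_eq_norm_sq]
      nlinarith)
    rw [inner_sub_right, real_inner_smul_right, real_inner_smul_right,
      real_inner_self_eq_norm_sq, real_inner_comm] at this
    nlinarith
  have heq := (inner_eq_norm_mul_iff_real).mp (le_antisymm (real_inner_le_norm a b) hab)
  rw [inv_smul_eq_iff₀ ha0.ne', smul_comm, eq_comm, inv_smul_eq_iff₀ hb0.ne']
  exact heq.symm

/-- Vectors orthogonal to the normal are tangent to the boundary. -/
lemma IsDefiningFunctionAt.mem_tangentConeAt {D : Set E3} (hD : IsOpen D) {p : E3}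
    (hp : p ∈ frontier D) {ρ : E3 → ℝ} (h : IsDefiningFunctionAt D p ρ) {v : E3}
    (hv : ⟪gradient ρ p, v⟫_ℝ = 0) : v ∈ tangentConeAt ℝ (frontier D) p := by
  have h0 := h.eq_zero hD hp
  set g := gradient ρ p with hg
  have hg0 : 0 < ‖g‖ ^ 2 := by
    have := norm_pos_iff.mpr h.gradient_ne_zero
    positivity
  have hn : ∀ k : ℕ, ∃ s : ℝ, 0 < s ∧ s < 1 / (k + 1 : ℝ) ∧
      ∃ r : ℝ, |r| ≤ 1 / (k + 1 : ℝ) ∧ p + s • (v + r • g) ∈ frontier D := by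
    intro k
    set δ : ℝ := 1 / (k + 1 : ℝ) with hδ
    have hδ0 : 0 < δ := by positivity
    have hin := h.eventually_mem h0 (v := v + (-δ) • g) (by
      rw [inner_add_right, real_inner_smul_right, ← hg, hv, real_inner_self_eq_norm_sq]
      nlinarith)
    have hout := h.eventually_notMem h0 (v := v + δ • g) (by
      rw [inner_add_right, real_inner_smul_right, ← hg, hv, real_inner_self_eq_norm_sq]
      nlinarith)
    have hpos : ∀ᶠ s in 𝓝[>] (0 : ℝ), 0 < s := self_mem_nhdsWithin
    have hlt : ∀ᶠ s in 𝓝[>] (0 : ℝ), s < δ := mem_nhdsWithin_of_mem_nhds (Iio_mem_nhds hδ0)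
    obtain ⟨s, h1, h2, h3, h4⟩ := (hin.and (hout.and (hpos.and hlt))).exists
    refine ⟨s, h3, h4, ?_⟩
    have hconn : IsPreconnected ((fun r : ℝ => p + s • (v + r • g)) '' Icc (-δ) δ) :=
      isPreconnected_Icc.image _ (by fun_prop)
    by_contra! hno
    have hno' : ∀ r ∈ Icc (-δ) δ, p + s • (v + r • g) ∉ closure D \ D := by
      intro r hr
      rw [← hD.frontier_eq]
      exact hno r (abs_le.mpr hr)
    obtain ⟨y, -, hy1, hy2⟩ := hconn D (closure D)ᶜ hD isClosed_closure.isOpen_compl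
      (by
        rintro _ ⟨r, hr, rfl⟩
        by_cases hr' : p + s • (v + r • g) ∈ D
        · exact Or.inl hr'
        · exact Or.inr fun hc => hno' r hr ⟨hc, hr'⟩)
      ⟨_, ⟨-δ, ⟨le_rfl, by linarith⟩, rfl⟩, h1⟩
      ⟨_, ⟨δ, ⟨by linarith, le_rfl⟩, rfl⟩, fun hc => hno' δ ⟨by linarith, le_rfl⟩ ⟨hc, h2⟩⟩
    exact hy2 (subset_closure hy1)
  choose s hs0 hs1 r hr hmem using hn
  have hlim := tendsto_one_div_add_atTop_nhds_zero_nat (𝕜 := ℝ)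
  have hs : Tendsto s atTop (𝓝 0) :=
    squeeze_zero (fun k => (hs0 k).le) (fun k => (hs1 k).le) hlim
  have hr' : Tendsto r atTop (𝓝 0) := squeeze_zero_norm hr hlim
  have hvr : Tendsto (fun k => v + r k • g) atTop (𝓝 v) := by
    simpa using tendsto_const_nhds.add (hr'.smul_const g)
  refine mem_tangentConeAt_of_seq atTop (fun k => (s k)⁻¹) (fun k => s k • (v + r k • g))
    (by simpa using hs.smul hvr) (Eventually.of_forall hmem) ?_
  refine hvr.congr fun k => ?_
  rw [inv_smul_smul₀ (hs0 k).ne']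

/-- If the field `V` on the boundary of `D` has an extension `W` that is differentiable at `x`,
then its surface divergence is `∑ i, (∂ᵢ Wᵢ - nᵢ (n · ∇) Wᵢ)`. -/
theorem surfDiv_eq {D : Set E3} (hD : IsBoundedSmoothDomain D) {x : E3} (hx : x ∈ frontier D)
    {V W : E3 → E3} (hVW : EqOn V W (frontier D)) (hW : DifferentiableAt ℝ W x) :
    surfDiv (frontier D) (outerNormal D) V x =
      ∑ i : Fin 3, ((fderiv ℝ W x (EuclideanSpace.single i 1)) i
        - outerNormal D x i * (fderiv ℝ W x (outerNormal D x)) i) := by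
  obtain ⟨ρ, h⟩ := hD.smooth_boundary x hx
  have hn := outerNormal_eq hD.isOpen hx h
  have hW' : HasFDerivWithinAt V (fderiv ℝ W x) (frontier D) x :=
    hW.hasFDerivAt.hasFDerivWithinAt.congr hVW (hVW hx)
  have huniq := hW'.differentiableWithinAt.hasFDerivWithinAt.unique_on hW'
  refine Finset.sum_congr rfl fun i _ => ?_
  have hg : ‖gradient ρ x‖ ≠ 0 := norm_ne_zero_iff.mpr h.gradient_ne_zero
  rw [huniq (h.mem_tangentConeAt hD.isOpen hx (v := tangentProj _ x _) ?_)]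
  · simp [tangentProj, EuclideanSpace.inner_single_right]
  · rw [tangentProj, hn, inner_sub_right, real_inner_smul_left, real_inner_smul_right,
      real_inner_smul_right, real_inner_self_eq_norm_sq]
    field_simp
    ring

end ThermalDiffusion

end

open ThermalDiffusion

/-! The energy is quadratic in the temperatures, so its derivative at `ε = 0` is minus the sum of
three weighted Dirichlet pairings (`hasDerivAt_thermalEnergy`). Equating it with the given
derivative yields a weak formulation, `IsFirstVariation`. Test functions supported inside one phase
give the two bulk equations by the fundamental lemma of the calculus of variations.

On the interface, a single `ψ` supported near `p ∈ Γ` and inside `Ω` is used in all three slots. The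
divergence theorem in `Ω_A` (outer normal `n`) and in `Ω_B` (outer normal `-n` along `Γ`) turns the
bulk pairings into flux integrals over `Γ`, up to bulk terms that cancel by the bulk equations; the
surface pairing is integrated by parts on `Γ`, which has no boundary. What remains is `∫_Γ ψ R = 0`,
where `R` is the residual of the interface equation. It is continuous on `Γ`, and every
neighbourhood of `p` meets `Γ` in positive area, so `R p = 0`.

The analytic tools are local. Near a boundary point the surface is a rotated `C¹` graph
(`exists_graph_chart`). The area formula for graphs (`comap_graphMap_euclideanHausdorffMeasure`) and
Fubini after a shear give the divergence theorem for Hausdorff measure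
(`exists_setIntegral_fderiv_eq`). The surface divergence theorem follows from the one in space:
applied to `∂_v G` in direction `u` and to `∂_u G` in direction `v`, it gives `∫ (n·u ∂_v G - n·v
∂_u G) = 0` by symmetry of second derivatives, and the surface divergence of a tangential field is a
sum of such integrands. -/

noncomputable section

namespace ThermalDiffusion

/-! ### Area formula for graphs. -/

section AreaFormula

open Module NNReal ENNReal

variable {V : Type*} [NormedAddCommGroup V]

/-- The parametrization of the graph of `g`. -/
def graphMap (g : V → ℝ) (y : V) : WithLp 2 (V × ℝ) := WithLp.toLp 2 (y, g y)

lemma norm_graphMap_sub_sq (g : V → ℝ) (y z : V) :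
    ‖graphMap g y - graphMap g z‖ ^ 2 = ‖y - z‖ ^ 2 + (g y - g z) ^ 2 := by
  rw [WithLp.prod_norm_sq_eq_of_L2]
  simp [graphMap]

lemma lipschitzWith_graphMap {g : V → ℝ} {K : ℝ≥0} (hg : LipschitzWith K g) :
    LipschitzWith (1 + K) (graphMap g) := by
  refine LipschitzWith.of_dist_le_mul fun y z => ?_
  have h := hg.dist_le_mul y z
  rw [Real.dist_eq] at h
  rw [dist_eq_norm, ← sq_le_sq₀ (norm_nonneg _) (by positivity), norm_graphMap_sub_sq]
  rw [dist_eq_norm] at *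
  have h2 : (g y - g z) ^ 2 ≤ (K * ‖y - z‖) ^ 2 := by
    rw [← sq_abs (g y - g z)]
    gcongr
  push_cast
  nlinarith [mul_nonneg K.coe_nonneg (sq_nonneg ‖y - z‖)]

lemma isClosedEmbedding_graphMap {g : V → ℝ} (hg : Continuous g) :
    IsClosedEmbedding (graphMap g) := by
  refine Function.LeftInverse.isClosedEmbedding (f := fun x => x.fst) (fun y => rfl) ?_ ?_
  · fun_prop
  · unfold graphMap; fun_prop

/-- The normalizing factor of `μHE[d]` depends only on `d`, so it is the same in both spaces and the
Lipschitz bound survives. -/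
lemma euclideanHausdorffMeasure_image_le {X Y : Type*} [EMetricSpace X] [EMetricSpace Y]
    [MeasurableSpace X] [BorelSpace X] [MeasurableSpace Y] [BorelSpace Y] {K : ℝ≥0} {f : X → Y}
    {s : Set X} (hf : LipschitzOnWith K f s) (d : ℕ) :
    μHE[d] (f '' s) ≤ (K : ℝ≥0∞) ^ d * μHE[d] s := by
  have := hf.hausdorffMeasure_image_le (d := (d : ℝ)) (by positivity)
  simp only [Measure.euclideanHausdorffMeasure_def, Measure.smul_apply, ENNReal.smul_def,
    smul_eq_mul]
  rw [ENNReal.rpow_natCast] at this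
  calc _ ≤ _ := mul_le_mul_right this _
    _ = _ := by ring

variable [InnerProductSpace ℝ V] [FiniteDimensional ℝ V] [MeasurableSpace V] [BorelSpace V]

/-- The area of the graph of a linear function. -/
lemma euclideanHausdorffMeasure_image_graphMap_inner (w : V) (S : Set V) :
    μHE[finrank ℝ V] (graphMap (fun a => ⟪w, a⟫_ℝ) '' S)
      = ENNReal.ofReal √(1 + ‖w‖ ^ 2) * volume S := by
  set s := √(1 + ‖w‖ ^ 2) with hs
  have hs2 : s ^ 2 = 1 + ‖w‖ ^ 2 := Real.sq_sqrt (by positivity)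
  have hs0 : 0 < s := Real.sqrt_pos.mpr (by positivity)
  -- `B = I + w ⊗ w / (1 + s)` is the positive square root of `I + w ⊗ w`, the metric induced on the
  -- graph. Hence `B⁻¹` followed by the graph map is an isometry, and the area factor is `det B =
  -- s`.
  set B : V →ₗ[ℝ] V := LinearMap.transvection (innerₛₗ ℝ w) ((1 + s)⁻¹ • w) with hB
  have hBa (a : V) : B a = a + ⟪w, a⟫_ℝ • (1 + s)⁻¹ • w := by
    simp [hB, LinearMap.transvection]
  have hdet : LinearMap.det B = s := by
    rw [hB, LinearMap.transvection.det]
    simp only [map_smul, innerₛₗ_apply_apply, real_inner_self_eq_norm_sq, smul_eq_mul]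
    field_simp
    nlinarith
  have hnorm (a : V) : ‖B a‖ ^ 2 = ‖a‖ ^ 2 + ⟪w, a⟫_ℝ ^ 2 := by
    rw [hBa, norm_add_sq_real, real_inner_smul_right, real_inner_smul_right, norm_smul, norm_smul,
      real_inner_comm, mul_pow, mul_pow, Real.norm_eq_abs, Real.norm_eq_abs, sq_abs, sq_abs,
      show ‖w‖ ^ 2 = s ^ 2 - 1 by linarith]
    field_simp
    ring
  let Be : V ≃ₗ[ℝ] V := B.equivOfDetNeZero (by rw [hdet]; exact hs0.ne')
  have hiso : Isometry (fun b => graphMap (fun a => ⟪w, a⟫_ℝ) (Be.symm b)) := by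
    refine Isometry.of_dist_eq fun b c => ?_
    rw [dist_eq_norm, dist_eq_norm, ← sq_eq_sq₀ (norm_nonneg _) (norm_nonneg _),
      norm_graphMap_sub_sq, ← inner_sub_right, ← map_sub, ← hnorm]
    congr 2
    exact Be.apply_symm_apply (b - c)
  have himg : graphMap (fun a => ⟪w, a⟫_ℝ) '' S
      = (fun b => graphMap (fun a => ⟪w, a⟫_ℝ) (Be.symm b)) '' (B '' S) := by
    rw [image_image]
    refine image_congr fun a _ => ?_
    congr 1
    exact (Be.symm_apply_apply a).symm
  rw [himg, hiso.euclideanHausdorffMeasure_image, InnerProductSpace.euclideanHausdorffMeasure_eq_volume,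
    Measure.addHaar_image_linearMap, hdet, abs_of_pos hs0]

/-- The graphs of `g` and of its linearization are matched by keeping the base point. Strict
differentiability makes this matching `c`-Lipschitz in both directions near `y₀`, so the areas
differ at most by the factor `c ^ finrank ℝ V`. -/
lemma graph_comparison {g : V → ℝ} {w y₀ : V}
    (hg : HasStrictFDerivAt g (innerSL ℝ w) y₀) {c : ℝ≥0} (hc : 1 < c) :
    ∃ N ∈ 𝓝 y₀, ∀ S ⊆ N,
      μHE[finrank ℝ V] (graphMap g '' S)
          ≤ (c : ℝ≥0∞) ^ finrank ℝ V * (ENNReal.ofReal √(1 + ‖w‖ ^ 2) * volume S) ∧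
      ENNReal.ofReal √(1 + ‖w‖ ^ 2) * volume S
          ≤ (c : ℝ≥0∞) ^ finrank ℝ V * μHE[finrank ℝ V] (graphMap g '' S) := by
  have hc' : (1 : ℝ) < c := by exact_mod_cast hc
  obtain ⟨δ, hδ0, hδ1, hδ2⟩ : ∃ δ : ℝ, 0 < δ ∧ 1 + δ ≤ c ∧ 1 ≤ c * (1 - δ) := by
    -- With `δ = 1 - 1/c` the last inequality is an equality, and `1 + δ ≤ c` is `2 ≤ c + 1/c`.
    refine ⟨1 - (c : ℝ)⁻¹, ?_, ?_, ?_⟩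
    · have := inv_lt_one_of_one_lt₀ hc'; linarith
    · have : 0 < (c : ℝ) := by linarith
      have h2 : (c : ℝ) * (c : ℝ)⁻¹ = 1 := mul_inv_cancel₀ this.ne'
      have h3 : 0 < (c : ℝ)⁻¹ := by positivity
      nlinarith
    · have : 0 < (c : ℝ) := by linarith
      simp [this.ne']
  set A := graphMap (fun a => ⟪w, a⟫_ℝ) with hA
  have hev := (Asymptotics.isLittleO_iff.mp hg.isLittleO) hδ0
  rw [nhds_prod_eq] at hev
  obtain ⟨N, hN, hNp⟩ := (eventually_prod_self_iff (r := fun y z => ‖g y - g z - innerSL ℝ w (y - z)‖ ≤ δ * ‖y - z‖)).mp hev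
  have hdiff : ∀ y ∈ N, ∀ z ∈ N, ‖graphMap g y - graphMap g z - (A y - A z)‖ ≤ δ * ‖A y - A z‖ := by
    intro y hy z hz
    have h1 : ‖graphMap g y - graphMap g z - (A y - A z)‖ = ‖g y - g z - innerSL ℝ w (y - z)‖ := by
      rw [← sq_eq_sq₀ (norm_nonneg _) (norm_nonneg _), WithLp.prod_norm_sq_eq_of_L2]
      simp [graphMap, hA, inner_sub_right]
    have h2 : ‖y - z‖ ≤ ‖A y - A z‖ := by
      rw [← sq_le_sq₀ (norm_nonneg _) (norm_nonneg _), hA, norm_graphMap_sub_sq]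
      nlinarith [sq_nonneg (⟪w, y⟫_ℝ - ⟪w, z⟫_ℝ)]
    rw [h1]
    exact (hNp y hy z hz).trans (by gcongr)
  refine ⟨N, hN, fun S hS => ?_⟩
  rw [← euclideanHausdorffMeasure_image_graphMap_inner, ← hA]
  constructor
  · have : graphMap g '' S = (fun x => graphMap g x.fst) '' (A '' S) := by
      rw [image_image]; rfl
    rw [this]
    refine euclideanHausdorffMeasure_image_le (LipschitzOnWith.of_dist_le_mul ?_) _
    rintro _ ⟨y, hy, rfl⟩ _ ⟨z, hz, rfl⟩
    have h := hdiff y (hS hy) z (hS hz)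
    have h2 := norm_le_norm_add_norm_sub' (graphMap g y - graphMap g z) (A y - A z)
    change dist (graphMap g y) (graphMap g z) ≤ _
    rw [dist_eq_norm, dist_eq_norm]
    nlinarith [norm_nonneg (A y - A z)]
  · have : A '' S = (fun x => A x.fst) '' (graphMap g '' S) := by
      rw [image_image]; rfl
    rw [this]
    refine euclideanHausdorffMeasure_image_le (LipschitzOnWith.of_dist_le_mul ?_) _
    rintro _ ⟨y, hy, rfl⟩ _ ⟨z, hz, rfl⟩
    have h := hdiff y (hS hy) z (hS hz)
    have h2 := norm_le_norm_add_norm_sub (graphMap g y - graphMap g z) (A y - A z)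
    change dist (A y) (A z) ≤ _
    rw [dist_eq_norm, dist_eq_norm]
    have h3 : (1 - δ) * ‖A y - A z‖ ≤ ‖graphMap g y - graphMap g z‖ := by linarith
    have h4 := mul_le_mul_of_nonneg_left h3 c.coe_nonneg
    nlinarith [norm_nonneg (A y - A z)]

/-- The area formula for graphs. -/
theorem comap_graphMap_euclideanHausdorffMeasure {g : V → ℝ} {K : ℝ≥0} (hg : ContDiff ℝ 1 g)
    (hgK : LipschitzWith K g) :
    (μHE[finrank ℝ V]).comap (graphMap g)
      = (volume : Measure V).withDensity fun y => ENNReal.ofReal √(1 + ‖gradient g y‖ ^ 2) := by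
  have hemb := (isClosedEmbedding_graphMap hg.continuous).measurableEmbedding
  set ν := (μHE[finrank ℝ V]).comap (graphMap g) with hν
  have hνle (S : Set V) : ν S ≤ ((1 + K : ℝ≥0) : ℝ≥0∞) ^ finrank ℝ V * volume S := by
    rw [hν, hemb.comap_apply, ← InnerProductSpace.euclideanHausdorffMeasure_eq_volume]
    exact euclideanHausdorffMeasure_image_le ((lipschitzWith_graphMap hgK).lipschitzOnWith) _
  have hac : ν ≪ volume := by
    intro S hS
    have := hνle S
    rwa [hS, mul_zero, nonpos_iff_eq_zero] at this
  have : IsLocallyFiniteMeasure ν := by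
    refine ⟨fun x => ⟨Metric.ball x 1, Metric.ball_mem_nhds x one_pos, ?_⟩⟩
    refine (hνle _).trans_lt (ENNReal.mul_lt_top ?_ measure_ball_lt_top)
    exact ENNReal.pow_lt_top ENNReal.coe_lt_top
  rw [← Measure.withDensity_rnDeriv_eq ν volume hac]
  refine withDensity_congr_ae ?_
  -- At almost every `y` the density is the limit of `ν S / volume S` as `S` shrinks to `y`.
  -- `graph_comparison` confines these quotients up to powers of `c`, and then `c` decreases to `1`.
  let v := Besicovitch.vitaliFamily (volume : Measure V)
  filter_upwards [v.ae_tendsto_rnDeriv ν, v.ae_eventually_measure_pos] with y hy hpos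
  have hgy : HasStrictFDerivAt g (innerSL ℝ (gradient g y)) y := by
    have := (hg.contDiffAt (x := y)).hasStrictFDerivAt (by simp)
    rwa [show fderiv ℝ g y = innerSL ℝ (gradient g y) by ext a; simp [gradient]] at this
  have hlim (J : ℝ≥0∞) : Tendsto (fun c : ℝ≥0 => (c : ℝ≥0∞) ^ finrank ℝ V * J) (𝓝[>] 1) (𝓝 J) := by
    have h1 : Tendsto (fun c : ℝ≥0 => (c : ℝ≥0∞) ^ finrank ℝ V) (𝓝 1) (𝓝 1) := by
      have : Continuous fun c : ℝ≥0 => (c : ℝ≥0∞) ^ finrank ℝ V := by fun_prop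
      simpa using this.tendsto 1
    simpa using (ENNReal.Tendsto.mul_const h1 (Or.inl one_ne_zero)).mono_left nhdsWithin_le_nhds
  have hbound : ∀ c : ℝ≥0, 1 < c →
      ν.rnDeriv volume y ≤ (c : ℝ≥0∞) ^ finrank ℝ V * ENNReal.ofReal √(1 + ‖gradient g y‖ ^ 2) ∧
      ENNReal.ofReal √(1 + ‖gradient g y‖ ^ 2) ≤ (c : ℝ≥0∞) ^ finrank ℝ V * ν.rnDeriv volume y := by
    intro c hc
    obtain ⟨N, hN, hcmp⟩ := graph_comparison hgy hc
    have hev := (v.eventually_filterAt_subset_of_nhds hN).and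
      (hpos.and (v.eventually_measure_lt_top y))
    constructor
    · refine le_of_tendsto hy ?_
      filter_upwards [hev] with S ⟨hS, h0, htop⟩
      rw [ENNReal.div_le_iff h0.ne' htop.ne, hν, hemb.comap_apply, mul_assoc]
      exact (hcmp S hS).1
    · refine ge_of_tendsto (ENNReal.Tendsto.const_mul hy (Or.inr (by simp))) ?_
      filter_upwards [hev] with S ⟨hS, h0, htop⟩
      rw [← mul_div_assoc, ENNReal.le_div_iff_mul_le (Or.inl h0.ne') (Or.inl htop.ne), hν,
        hemb.comap_apply]
      exact (hcmp S hS).2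
  refine le_antisymm (ge_of_tendsto (hlim _) ?_) (ge_of_tendsto (hlim _) ?_)
  · filter_upwards [self_mem_nhdsWithin] with c hc using (hbound c hc).1
  · filter_upwards [self_mem_nhdsWithin] with c hc using (hbound c hc).2

/-- Integration over a graph. -/
theorem setIntegral_range_graphMap {g : V → ℝ} {K : ℝ≥0} (hg : ContDiff ℝ 1 g)
    (hgK : LipschitzWith K g) (h : WithLp 2 (V × ℝ) → ℝ) :
    ∫ x in range (graphMap g), h x ∂μHE[finrank ℝ V]
      = ∫ y, √(1 + ‖gradient g y‖ ^ 2) * h (graphMap g y) := by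
  have hemb := (isClosedEmbedding_graphMap hg.continuous).measurableEmbedding
  rw [← hemb.map_comap, hemb.integral_map, comap_graphMap_euclideanHausdorffMeasure hg hgK,
    integral_withDensity_eq_integral_toReal_smul₀]
  · simp [ENNReal.toReal_ofReal, Real.sqrt_nonneg]
  · have : Continuous (gradient g) :=
      (InnerProductSpace.toDual ℝ V).symm.continuous.comp (hg.continuous_fderiv (by simp))
    have h2 : Continuous fun y => √(1 + ‖gradient g y‖ ^ 2) := by fun_prop
    exact (ENNReal.continuous_ofReal.comp h2).measurable.aemeasurable
  · simp

end AreaFormula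

/-! ### Divergence theorem below a graph. -/

section Subgraph

variable {V : Type*} [NormedAddCommGroup V] [InnerProductSpace ℝ V] [FiniteDimensional ℝ V]
  [MeasurableSpace V] [BorelSpace V]

/-- The integral of a derivative of a compactly supported function vanishes. -/
lemma integral_fderiv_apply_eq_zero {f : V → ℝ} (hf : ContDiff ℝ 1 f) (hfc : HasCompactSupport f)
    (v : V) : ∫ x, fderiv ℝ f x v = 0 := by
  have hi : Integrable (fun x => fderiv ℝ f x v) :=
    Continuous.integrable_of_hasCompactSupport
      ((hf.continuous_fderiv (by simp)).clm_apply continuous_const) (hfc.fderiv_apply ℝ v)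
  have h := integral_mul_fderiv_eq_neg_fderiv_mul_of_integrable (μ := (volume : Measure V))
    (f := fun _ => (1 : ℝ)) (g := f) (v := v) (by simp) (by simpa using hi)
    (by simpa using hf.continuous.integrable_of_hasCompactSupport hfc)
    (fun x _ => by fun_prop) (fun x _ => hf.differentiable (by simp) x)
  simpa using h

/-- The shear which flattens the graph of `g`. -/
def shear (g : V → ℝ) (hg : Continuous g) : V × ℝ ≃ₜ V × ℝ where
  toFun x := (x.1, g x.1 + x.2)
  invFun x := (x.1, x.2 - g x.1)
  left_inv x := by simp
  right_inv x := by simp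
  continuous_toFun := by fun_prop
  continuous_invFun := by fun_prop

lemma measurePreserving_shear (g : V → ℝ) (hg : Continuous g) :
    MeasurePreserving (shear g hg) (volume : Measure (V × ℝ)) volume := by
  rw [Measure.volume_eq_prod]
  refine (MeasurePreserving.id volume).skew_product (g := fun y t => g y + t) ?_ ?_
  · fun_prop
  · filter_upwards with y using (measurePreserving_add_left volume (g y)).map_eq

/-- The divergence theorem in a half space, for constant directions. -/
lemma setIntegral_halfspace_fderiv {H : V × ℝ → ℝ} (hH : ContDiff ℝ 1 H)
    (hHc : HasCompactSupport H) {c : V → ℝ} (hc : Continuous c) (a : V) :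
    ∫ x in univ ×ˢ Iio (0 : ℝ), (fderiv ℝ H x (a, 0) + c x.1 * fderiv ℝ H x (0, 1))
      = ∫ y, c y * H (y, 0) := by
  have hcont (w : V × ℝ) : Continuous fun x => fderiv ℝ H x w :=
    (hH.continuous_fderiv (by simp)).clm_apply continuous_const
  have hi1 : Integrable (fun x => fderiv ℝ H x (a, 0)) :=
    (hcont _).integrable_of_hasCompactSupport (hHc.fderiv_apply ℝ _)
  have hi2 : Integrable (fun x => c x.1 * fderiv ℝ H x (0, 1)) :=
    ((hc.comp continuous_fst).mul (hcont _)).integrable_of_hasCompactSupport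
      (hHc.fderiv_apply ℝ _).mul_left
  rw [integral_add hi1.integrableOn hi2.integrableOn]
  -- By Fubini, horizontal derivatives integrate to zero on each horizontal slice, while vertical
  -- ones leave the value at height `0`, since `c` does not depend on the height.
  have hy (τ : ℝ) : ∫ y : V, fderiv ℝ H (y, τ) (a, 0) = 0 := by
    have hd : ContDiff ℝ 1 fun y => H (y, τ) := hH.comp (by fun_prop)
    have hs : HasCompactSupport fun y => H (y, τ) :=
      hHc.comp_isClosedEmbedding (Function.LeftInverse.isClosedEmbedding (f := Prod.fst)
        (fun _ => rfl) continuous_fst (by fun_prop))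
    refine Eq.trans ?_ (integral_fderiv_apply_eq_zero hd hs a)
    congr 1 with y
    have h1 : HasFDerivAt (fun y : V => (y, τ)) (ContinuousLinearMap.inl ℝ V ℝ) y :=
      hasFDerivAt_prodMk_left y τ
    have := ((hH.differentiable (by simp) (y, τ)).hasFDerivAt.comp y h1).fderiv
    rw [Function.comp_def] at this
    rw [this]; simp
  have hτ (y : V) : ∫ τ in Iio (0 : ℝ), fderiv ℝ H (y, τ) (0, 1) = H (y, 0) := by
    have hd : ContDiff ℝ 1 fun τ => H (y, τ) := hH.comp (by fun_prop)
    have hs : HasCompactSupport fun τ => H (y, τ) :=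
      hHc.comp_isClosedEmbedding (Function.LeftInverse.isClosedEmbedding (f := Prod.snd)
        (fun _ => rfl) continuous_snd (by fun_prop))
    rw [← integral_Iic_eq_integral_Iio, ← hs.integral_Iic_deriv_eq hd 0]
    congr 1 with τ
    have h1 : HasFDerivAt (fun τ : ℝ => (y, τ)) (ContinuousLinearMap.inr ℝ V ℝ) τ :=
      hasFDerivAt_prodMk_right y τ
    have := ((hH.differentiable (by simp) (y, τ)).hasFDerivAt.comp τ h1).hasDerivAt.deriv
    rw [Function.comp_def] at this
    rw [this]; simp
  have h1 : ∫ x in univ ×ˢ Iio (0 : ℝ), fderiv ℝ H x (a, 0) = 0 := by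
    rw [Measure.volume_eq_prod, ← Measure.prod_restrict, integral_prod_symm]
    · simp [hy]
    · rw [Measure.prod_restrict, ← Measure.volume_eq_prod]; exact hi1.integrableOn
  have h2 : ∫ x in univ ×ˢ Iio (0 : ℝ), c x.1 * fderiv ℝ H x (0, 1) = ∫ y, c y * H (y, 0) := by
    rw [Measure.volume_eq_prod, setIntegral_prod]
    · simp [integral_const_mul, hτ]
    · rw [← Measure.volume_eq_prod]; exact hi2.integrableOn
  rw [h1, h2, zero_add]

/-- The divergence theorem in a subgraph, for constant directions. -/
theorem setIntegral_subgraph_fderiv {F : V × ℝ → ℝ} (hF : ContDiff ℝ 1 F)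
    (hFc : HasCompactSupport F) {g : V → ℝ} (hg : ContDiff ℝ 1 g) (a : V) (s : ℝ) :
    ∫ x in {x : V × ℝ | x.2 < g x.1}, fderiv ℝ F x (a, s)
      = ∫ y, (s - fderiv ℝ g y a) * F (y, g y) := by
  have hgc := hg.continuous
  have hmp := measurePreserving_shear g hgc
  rw [← hmp.setIntegral_preimage_emb (shear g hgc).measurableEmbedding]
  have hpre : shear g hgc ⁻¹' {x : V × ℝ | x.2 < g x.1} = univ ×ˢ Iio (0 : ℝ) := by
    ext x; simp [shear]
  have hsm : ContDiff ℝ 1 (shear g hgc) := by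
    change ContDiff ℝ 1 fun x : V × ℝ => (x.1, g x.1 + x.2)
    fun_prop
  have hH : ContDiff ℝ 1 (F ∘ shear g hgc) := hF.comp hsm
  have hHc : HasCompactSupport (F ∘ shear g hgc) := hFc.comp_homeomorph _
  -- The shear maps the direction `(a, s - Dg a)` to `(a, s)`. Its last component depends on the
  -- base point only, and is the coefficient `c` of the half space version.
  have hc : Continuous fun y => s - fderiv ℝ g y a :=
    continuous_const.sub ((hg.continuous_fderiv (by simp)).clm_apply continuous_const)
  have key := setIntegral_halfspace_fderiv hH hHc hc a
  rw [hpre]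
  have hR : ∀ y, (F ∘ shear g hgc) (y, 0) = F (y, g y) := fun y => by simp [shear]
  simp only [hR] at key
  rw [← key]
  congr 1 with x
  have hgd : HasFDerivAt g (fderiv ℝ g x.1) x.1 := (hg.differentiable (by simp) x.1).hasFDerivAt
  have hsd : HasFDerivAt (shear g hgc)
      ((ContinuousLinearMap.fst ℝ V ℝ).prod
        ((fderiv ℝ g x.1).comp (ContinuousLinearMap.fst ℝ V ℝ) + ContinuousLinearMap.snd ℝ V ℝ)) x :=
    hasFDerivAt_fst.prodMk ((hgd.comp x hasFDerivAt_fst).add hasFDerivAt_snd)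
  have hd := ((hF.differentiable (by simp) _).hasFDerivAt.comp x hsd).fderiv
  rw [hd]
  simp only [ContinuousLinearMap.comp_apply, ContinuousLinearMap.prod_apply,
    add_apply, ContinuousLinearMap.coe_fst', ContinuousLinearMap.coe_snd',
    map_zero, add_zero, zero_add]
  rw [← smul_eq_mul, ← map_smul, ← map_add]
  simp

end Subgraph

/-! ### Graphs in rotated coordinates. -/

section Transport

open Module

variable {V X : Type*} [NormedAddCommGroup V] [InnerProductSpace ℝ V] [NormedAddCommGroup X]
  [InnerProductSpace ℝ X]

/-- Coordinates given by an isometry, as a continuous linear equivalence of a product. -/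
def graphCoord (Φ : WithLp 2 (V × ℝ) ≃ₗᵢ[ℝ] X) : (V × ℝ) ≃L[ℝ] X :=
  (WithLp.prodContinuousLinearEquiv 2 ℝ V ℝ).symm.trans Φ.toContinuousLinearEquiv

lemma graphCoord_apply (Φ : WithLp 2 (V × ℝ) ≃ₗᵢ[ℝ] X) (x : V × ℝ) :
    graphCoord Φ x = Φ (WithLp.toLp 2 x) := rfl

lemma graphCoord_symm_apply (Φ : WithLp 2 (V × ℝ) ≃ₗᵢ[ℝ] X) (x : X) :
    (graphCoord Φ).symm x = ((Φ.symm x).fst, (Φ.symm x).snd) := rfl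

variable [FiniteDimensional ℝ V]

/-- The upward normal `(-∇g, 1)` of the graph of `g`. -/
def graphNormal (g : V → ℝ) (y : V) : WithLp 2 (V × ℝ) := WithLp.toLp 2 (-gradient g y, 1)

lemma norm_graphNormal (g : V → ℝ) (y : V) : ‖graphNormal g y‖ = √(1 + ‖gradient g y‖ ^ 2) := by
  rw [← Real.sqrt_sq (norm_nonneg (graphNormal g y)), WithLp.prod_norm_sq_eq_of_L2]
  simp [graphNormal, add_comm]

lemma inner_graphNormal (g : V → ℝ) (y : V) (w : WithLp 2 (V × ℝ)) :
    ⟪graphNormal g y, w⟫_ℝ = w.snd - fderiv ℝ g y w.fst := by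
  rw [WithLp.prod_inner_apply]
  simp [graphNormal, gradient, inner_neg_left]
  ring

variable [MeasurableSpace V] [BorelSpace V] [MeasurableSpace X] [BorelSpace X]

lemma setIntegral_graph {g : V → ℝ} (hg : ContDiff ℝ 1 g) (hgc : HasCompactSupport g)
    (Φ : WithLp 2 (V × ℝ) ≃ₗᵢ[ℝ] X) (h : X → ℝ) :
    ∫ x in {x | ((graphCoord Φ).symm x).2 = g ((graphCoord Φ).symm x).1}, h x ∂μHE[finrank ℝ V]
      = ∫ y, ‖graphNormal g y‖ * h (graphCoord Φ (y, g y)) := by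
  -- Compact support supplies the global Lipschitz constant that the area formula asks for.
  obtain ⟨K, hK⟩ := hg.lipschitzWith_of_hasCompactSupport hgc (by simp)
  have hmp := Φ.toIsometryEquiv.measurePreserving_euclideanHausdorffMeasure (finrank ℝ V)
  rw [← hmp.setIntegral_preimage_emb Φ.toHomeomorph.measurableEmbedding]
  simp only [norm_graphNormal]
  have := setIntegral_range_graphMap hg hK (fun x => h (Φ x))
  simp only [graphMap] at this
  simp only [graphCoord_apply]
  rw [← this]
  congr 2
  ext x
  simp only [graphCoord_symm_apply, LinearIsometryEquiv.coe_toIsometryEquiv, mem_preimage,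
    mem_ofPred_eq, LinearIsometryEquiv.symm_apply_apply, mem_range]
  constructor
  · intro hx
    exact ⟨x.fst, by unfold graphMap; rw [← hx]; rfl⟩
  · rintro ⟨y, rfl⟩
    rfl

variable [FiniteDimensional ℝ X]

lemma measurePreserving_graphCoord (Φ : WithLp 2 (V × ℝ) ≃ₗᵢ[ℝ] X) :
    MeasurePreserving (graphCoord Φ) volume volume :=
  Φ.measurePreserving.comp (WithLp.volume_preserving_toLp V ℝ)

/-- The divergence theorem for subgraphs, in rotated coordinates. -/
theorem setIntegral_subgraph_fderiv_apply {g : V → ℝ} (hg : ContDiff ℝ 1 g)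
    (hgc : HasCompactSupport g) (Φ : WithLp 2 (V × ℝ) ≃ₗᵢ[ℝ] X) {f : X → ℝ} (hf : ContDiff ℝ 1 f)
    (hfc : HasCompactSupport f) (v : X) :
    ∫ x in {x | ((graphCoord Φ).symm x).2 < g ((graphCoord Φ).symm x).1}, fderiv ℝ f x v
      = ∫ x in {x | ((graphCoord Φ).symm x).2 = g ((graphCoord Φ).symm x).1},
          f x * ⟪‖graphNormal g ((graphCoord Φ).symm x).1‖⁻¹ •
            Φ (graphNormal g ((graphCoord Φ).symm x).1), v⟫_ℝ ∂μHE[finrank ℝ V] := by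
  have hmp := measurePreserving_graphCoord Φ
  rw [setIntegral_graph hg hgc,
    ← hmp.setIntegral_preimage_emb (graphCoord Φ).toHomeomorph.measurableEmbedding]
  have key := setIntegral_subgraph_fderiv (F := f ∘ graphCoord Φ)
    (hf.comp (graphCoord Φ).contDiff) (hfc.comp_homeomorph (graphCoord Φ).toHomeomorph)
    hg ((graphCoord Φ).symm v).1 ((graphCoord Φ).symm v).2
  simp only [preimage_ofPred_eq, ContinuousLinearEquiv.symm_apply_apply]
  have hd (x : V × ℝ) : fderiv ℝ (f ∘ graphCoord Φ) x
      (((graphCoord Φ).symm v).1, ((graphCoord Φ).symm v).2) = fderiv ℝ f (graphCoord Φ x) v := by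
    rw [ContinuousLinearEquiv.comp_right_fderiv]
    simp
  simp only [hd] at key
  rw [key]
  congr 1 with y
  -- The area density `‖graphNormal g y‖` cancels the normalization of the unit normal.
  have hpos : ‖graphNormal g y‖ ≠ 0 := by
    rw [norm_graphNormal]; positivity
  have hin : ⟪Φ (graphNormal g y), v⟫_ℝ
      = ((graphCoord Φ).symm v).2 - fderiv ℝ g y ((graphCoord Φ).symm v).1 := by
    rw [← Φ.apply_symm_apply v, Φ.inner_map_map, inner_graphNormal, Φ.apply_symm_apply]
    rfl
  rw [real_inner_smul_left, hin, Function.comp_apply]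
  field_simp

end Transport

/-! ### Smooth boundaries as local graphs. -/

/-- There is a rotation which maps the last coordinate direction to a given one. -/
lemma exists_linearIsometryEquiv_apply_eq {V X : Type*} [NormedAddCommGroup V]
    [InnerProductSpace ℝ V] [FiniteDimensional ℝ V] [NormedAddCommGroup X] [InnerProductSpace ℝ X]
    [FiniteDimensional ℝ X] (hdim : Module.finrank ℝ X = Module.finrank ℝ V + 1) {e : X}
    (he : ‖e‖ = 1) : ∃ Φ : WithLp 2 (V × ℝ) ≃ₗᵢ[ℝ] X, Φ (WithLp.toLp 2 (0, 1)) = e := by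
  have hfr : Module.finrank ℝ (WithLp 2 (V × ℝ)) = Module.finrank ℝ X := by
    rw [hdim, (WithLp.linearEquiv 2 ℝ (V × ℝ)).finrank_eq]; simp
  let Φ₀ : WithLp 2 (V × ℝ) ≃ₗᵢ[ℝ] X :=
    LinearIsometryEquiv.trans (stdOrthonormalBasis ℝ (WithLp 2 (V × ℝ))).repr
      (((stdOrthonormalBasis ℝ X).reindex (finCongr hfr.symm)).repr.symm)
  set w := Φ₀ (WithLp.toLp 2 (0, 1)) with hw
  have hwn : ‖w‖ = ‖e‖ := by
    rw [he, hw, Φ₀.norm_map, ← Real.sqrt_sq (norm_nonneg _), WithLp.prod_norm_sq_eq_of_L2]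
    simp
  -- The reflection in the hyperplane orthogonal to `w - e` exchanges the equally long vectors `w`
  -- and `e`.
  exact ⟨Φ₀.trans (Submodule.reflection (ℝ ∙ (w - e))ᗮ), Submodule.reflection_sub hwn⟩

/-- A function which is continuously differentiable at a point agrees near this point with a
compactly supported function which is continuously differentiable everywhere. -/
lemma exists_contDiff_hasCompactSupport_eventuallyEq {V : Type*} [NormedAddCommGroup V]
    [InnerProductSpace ℝ V] [FiniteDimensional ℝ V] {f : V → ℝ} {y₀ : V}
    (hf : ContDiffAt ℝ 1 f y₀) :
    ∃ g : V → ℝ, ContDiff ℝ 1 g ∧ HasCompactSupport g ∧ g =ᶠ[𝓝 y₀] f := by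
  have hev := hf.eventually (by simp)
  obtain ⟨r, hr, hball⟩ := Metric.eventually_nhds_iff_ball.mp hev
  let χ : ContDiffBump y₀ := ⟨r / 4, r / 2, by positivity, by linarith⟩
  refine ⟨fun y => χ y * f y, ?_, χ.hasCompactSupport.mul_right, ?_⟩
  · rw [contDiff_iff_contDiffAt]
    intro y
    by_cases hy : y ∈ Metric.ball y₀ r
    · exact χ.contDiff.contDiffAt.mul (hball y hy)
    · have hy' : y ∉ tsupport χ := by
        rw [χ.tsupport_eq]
        simp only [Metric.mem_closedBall, Metric.mem_ball, χ] at *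
        linarith
      refine (contDiffAt_const (c := (0 : ℝ))).congr_of_eventuallyEq ?_
      filter_upwards [notMem_tsupport_iff_eventuallyEq.mp hy'] with z hz
      simp [hz]
  · filter_upwards [χ.eventuallyEq_one] with y hy
    simp [hy]

lemma IsDefiningFunctionAt.eventually {D : Set E3} {p : E3} {ρ : E3 → ℝ}
    (h : IsDefiningFunctionAt D p ρ) : ∀ᶠ x in 𝓝 p, IsDefiningFunctionAt D x ρ := by
  have hc : Continuous (gradient ρ) :=
    (InnerProductSpace.toDual ℝ E3).symm.continuous.comp (h.smooth.continuous_fderiv (by simp))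
  filter_upwards [h.mem_iff.eventually_nhds,
    hc.continuousAt.eventually_ne h.gradient_ne_zero] with x h1 h2
  exact ⟨h.smooth, h2, h1⟩

lemma IsDefiningFunctionAt.mem_frontier_iff {D : Set E3} (hD : IsOpen D) {p : E3} {ρ : E3 → ℝ}
    (h : IsDefiningFunctionAt D p ρ) : p ∈ frontier D ↔ ρ p = 0 := by
  refine ⟨h.eq_zero hD, fun h0 => ?_⟩
  rw [hD.frontier_eq]
  refine ⟨?_, fun hp => (h.mem_iff.self_of_nhds.mp hp).ne h0⟩
  have hin := h.eventually_mem h0 (v := -gradient ρ p) (by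
    rw [inner_neg_right, real_inner_self_eq_norm_sq]
    have := norm_pos_iff.mpr h.gradient_ne_zero
    nlinarith)
  exact mem_closure_of_tendsto (tendsto_line p _) hin

/-- The Euclidean plane. -/
abbrev E2 := EuclideanSpace ℝ (Fin 2)

/-- The last axis is rotated onto `∇ρ p`, so `ρ` increases strictly along it near `p`. The implicit
function theorem solves `ρ = 0` for the height, and monotonicity turns the sign of `ρ` into a
comparison with `g`. Cutting `g` off makes it global without changing it near `p`. -/
lemma exists_graph_chart {D : Set E3} (hD : IsOpen D) {p : E3} (hp : p ∈ frontier D) {ρ : E3 → ℝ}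
    (h : IsDefiningFunctionAt D p ρ) :
    ∃ (Φ : WithLp 2 (E2 × ℝ) ≃ₗᵢ[ℝ] E3) (g : E2 → ℝ), ContDiff ℝ 1 g ∧ HasCompactSupport g ∧
      ∀ᶠ x in 𝓝 p,
        (x ∈ D ↔ ((graphCoord Φ).symm x).2 < g ((graphCoord Φ).symm x).1) ∧
        (x ∈ frontier D ↔ ((graphCoord Φ).symm x).2 = g ((graphCoord Φ).symm x).1) ∧
        (x ∈ frontier D → outerNormal D x = ‖graphNormal g ((graphCoord Φ).symm x).1‖⁻¹ •
            Φ (graphNormal g ((graphCoord Φ).symm x).1)) := by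
  have hgn : 0 < ‖gradient ρ p‖ := norm_pos_iff.mpr h.gradient_ne_zero
  obtain ⟨Φ, hΦ⟩ := exists_linearIsometryEquiv_apply_eq (V := E2) (X := E3) (by simp)
    (e := ‖gradient ρ p‖⁻¹ • gradient ρ p) (by rw [norm_smul]; simp [hgn.ne'])
  set C := graphCoord Φ with hC
  set u := C.symm p with hu
  have hCu : C u = p := C.apply_symm_apply p
  set f : E2 × ℝ → ℝ := ρ ∘ C with hfdef
  have hf : ContDiff ℝ ∞ f := h.smooth.comp C.contDiff
  have hfu : f u = 0 := by rw [hfdef, Function.comp_apply, hCu]; exact h.eq_zero hD hp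
  have hfd (x w : E2 × ℝ) : fderiv ℝ f x w = ⟪gradient ρ (C x), C w⟫_ℝ := by
    rw [hfdef, ContinuousLinearEquiv.comp_right_fderiv]
    simp [gradient]
  have hfdu : 0 < fderiv ℝ f u (0, 1) := by
    rw [hfd, hCu, hC, graphCoord_apply, hΦ, real_inner_smul_right, real_inner_self_eq_norm_sq]
    positivity
  have hinv : (fderiv ℝ f u ∘L ContinuousLinearMap.inr ℝ E2 ℝ).IsInvertible := by
    refine ⟨ContinuousLinearEquiv.unitsEquivAut ℝ (Units.mk0 _ hfdu.ne'), ?_⟩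
    ext
    simp
  have hfat : ContDiffAt ℝ 1 f u := (hf.of_le (by simp)).contDiffAt
  obtain ⟨g, hg, hgc, hgeq⟩ := exists_contDiff_hasCompactSupport_eventuallyEq
    (hfat.contDiffAt_implicitFunction (by simp) hinv)
  have hgu : g u.1 = u.2 := by
    rw [hgeq.self_of_nhds]; exact hfat.implicitFunction_apply_self (by simp) hinv
  have hzero : ∀ᶠ y in 𝓝 u.1, f (y, g y) = 0 := by
    filter_upwards [hgeq, hfat.eventually_apply_implicitFunction (by simp) hinv] with y h1 h2
    rw [h1, h2, hfu]
  have hpos : ∀ᶠ x in 𝓝 u, 0 < fderiv ℝ f x (0, 1) := by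
    have : Continuous fun x => fderiv ℝ f x (0, 1) :=
      (hf.continuous_fderiv (by simp)).clm_apply continuous_const
    exact this.continuousAt.eventually (lt_mem_nhds hfdu)
  obtain ⟨r, hr, hball⟩ := Metric.eventually_nhds_iff_ball.mp hpos
  have hgr : ∀ᶠ y in 𝓝 u.1, g y ∈ Metric.ball u.2 r := by
    have := hg.continuous.continuousAt (x := u.1)
    rw [ContinuousAt, hgu] at this
    exact this.eventually (Metric.ball_mem_nhds _ hr)
  have hbox : ∀ᶠ y in 𝓝 u.1, f (y, g y) = 0 ∧ g y ∈ Metric.ball u.2 r ∧ y ∈ Metric.ball u.1 r :=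
    hzero.and (hgr.and (Metric.ball_mem_nhds _ hr))
  have hmono (y : E2) (hy : y ∈ Metric.ball u.1 r) :
      StrictMonoOn (fun s => f (y, s)) (Metric.ball u.2 r) := by
    refine strictMonoOn_of_deriv_pos (convex_ball _ _)
      (hf.continuous.comp (by fun_prop)).continuousOn fun s hs => ?_
    rw [Metric.isOpen_ball.interior_eq] at hs
    have h1 : HasFDerivAt (fun τ : ℝ => (y, τ)) (ContinuousLinearMap.inr ℝ E2 ℝ) s :=
      hasFDerivAt_prodMk_right y s
    have h2 := ((hf.differentiable (by simp) (y, s)).hasFDerivAt.comp s h1).hasDerivAt.deriv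
    rw [Function.comp_def] at h2
    rw [h2]
    simp only [ContinuousLinearMap.comp_apply, ContinuousLinearMap.inr_apply]
    exact hball _ (by rw [← ball_prod_same]; exact ⟨hy, hs⟩)
  refine ⟨Φ, g, hg, hgc, ?_⟩
  have hcs : Tendsto C.symm (𝓝 p) (𝓝 u) := C.symm.continuous.continuousAt
  have h1 : Tendsto (fun x => (C.symm x).1) (𝓝 p) (𝓝 u.1) := (continuous_fst.tendsto u).comp hcs
  have h2 : Tendsto (fun x => (C.symm x).2) (𝓝 p) (𝓝 u.2) := (continuous_snd.tendsto u).comp hcs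
  filter_upwards [h1.eventually hbox.eventually_nhds, h2.eventually (Metric.ball_mem_nhds _ hr),
    h.eventually] with x hx1 hx2 hdef
  obtain ⟨hx0, hxg, hxb⟩ := hx1.self_of_nhds
  have hρx : ρ x = f ((C.symm x).1, (C.symm x).2) := by
    rw [hfdef, Function.comp_apply, Prod.mk.eta, C.apply_symm_apply]
  refine ⟨?_, ?_, fun hxD => ?_⟩
  · rw [hdef.mem_iff.self_of_nhds, hρx, ← (hmono _ hxb).lt_iff_lt hx2 hxg, hx0]
  · rw [hdef.mem_frontier_iff hD, hρx, ← (hmono _ hxb).injOn.eq_iff hx2 hxg, hx0]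
  · rw [outerNormal_eq hD hxD hdef]
    set y := (C.symm x).1 with hy
    have hxs : (C.symm x).2 = g y := by
      rw [← (hmono _ hxb).injOn.eq_iff hx2 hxg, hx0, ← hρx]
      exact hdef.eq_zero hD hxD
    have hCx : C (y, g y) = x := by rw [← hxs, hy, Prod.mk.eta, C.apply_symm_apply]
    set c := fderiv ℝ f (y, g y) (0, 1) with hc
    have hc0 : 0 < c := hball _ (by rw [← ball_prod_same]; exact ⟨hxb, hxg⟩)
    -- Differentiating `f (y, g y) = 0` shows that `∇ρ` annihilates tangent vectors of the graph. It
    -- is therefore the multiple `c` of the graph normal, and `c > 0` fixes the orientation.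
    have htan (a : E2) : fderiv ℝ f (y, g y) (a, fderiv ℝ g y a) = 0 := by
      have hd : HasFDerivAt (fun z : E2 => (z, g z))
          ((ContinuousLinearMap.id ℝ E2).prod (fderiv ℝ g y)) y :=
        (hasFDerivAt_id y).prodMk (hg.differentiable (by simp) y).hasFDerivAt
      have h3 := (hf.differentiable (by simp) (y, g y)).hasFDerivAt.comp y hd
      have h4 : (f ∘ fun z : E2 => (z, g z)) =ᶠ[𝓝 y] fun _ => 0 := by
        filter_upwards [hx1] with z hz using hz.1
      have h5 := h3.unique ((hasFDerivAt_const (0 : ℝ) y).congr_of_eventuallyEq h4)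
      simpa using DFunLike.congr_fun h5 a
    have hgrad : gradient ρ x = c • Φ (graphNormal g y) := by
      refine ext_inner_right ℝ fun w => ?_
      rw [← C.apply_symm_apply w, ← hCx, ← hfd, real_inner_smul_left, hC, graphCoord_apply Φ,
        Φ.inner_map_map, inner_graphNormal]
      set a := ((graphCoord Φ).symm w).1
      set s := ((graphCoord Φ).symm w).2
      have hsplit : ((graphCoord Φ).symm w) = (a, fderiv ℝ g y a) + (s - fderiv ℝ g y a) • (0, 1) := by
        ext <;> simp [a, s]
      change _ = c * (s - fderiv ℝ g y a)
      rw [hsplit, map_add, map_smul, htan, zero_add, smul_eq_mul, mul_comm]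
    rw [hgrad, norm_smul, Φ.norm_map, Real.norm_eq_abs, abs_of_pos hc0, smul_smul]
    congr 1
    field_simp

/-! ### Divergence theorem and surface measure at a smooth boundary. -/

lemma setIntegral_congr_of_ne_zero {X : Type*} [MeasurableSpace X] {μ : Measure X} {s t : Set X}
    {F : X → ℝ} (hs : MeasurableSet s) (ht : MeasurableSet t)
    (h : ∀ x, F x ≠ 0 → (x ∈ s ↔ x ∈ t)) : ∫ x in s, F x ∂μ = ∫ x in t, F x ∂μ := by
  rw [← integral_indicator hs, ← integral_indicator ht]
  congr 1 with x
  by_cases hx : F x = 0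
  · rw [indicator_apply_eq_zero.mpr fun _ => hx, indicator_apply_eq_zero.mpr fun _ => hx]
  · by_cases hs : x ∈ s
    · rw [indicator_of_mem hs, indicator_of_mem ((h x hx).mp hs)]
    · rw [indicator_of_notMem hs, indicator_of_notMem (mt (h x hx).mpr hs)]

lemma fderiv_apply_ne_zero_mem_tsupport {f : E3 → ℝ} {v x : E3} (h : fderiv ℝ f x v ≠ 0) :
    x ∈ tsupport f := by
  by_contra hx
  exact h (by rw [fderiv_of_notMem_tsupport ℝ hx]; rfl)

/-- The local divergence theorem, for constant directions. -/
theorem exists_setIntegral_fderiv_eq {D : Set E3} (hD : IsOpen D) {p : E3} (hp : p ∈ frontier D)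
    {ρ : E3 → ℝ} (h : IsDefiningFunctionAt D p ρ) :
    ∃ U ∈ 𝓝 p, ∀ f : E3 → ℝ, ContDiff ℝ 1 f → HasCompactSupport f → tsupport f ⊆ U → ∀ v : E3,
      ∫ x in D, fderiv ℝ f x v
        = ∫ x in frontier D, f x * ⟪outerNormal D x, v⟫_ℝ ∂μHE[2] := by
  obtain ⟨Φ, g, hg, hgc, hev⟩ := exists_graph_chart hD hp h
  refine ⟨_, hev, fun f hf hfc hfU v => ?_⟩
  have key := setIntegral_subgraph_fderiv_apply hg hgc Φ hf hfc v
  rw [show Module.finrank ℝ E2 = 2 by simp] at key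
  have hc1 : Continuous fun x : E3 => g ((graphCoord Φ).symm x).1 :=
    hg.continuous.comp (continuous_fst.comp (graphCoord Φ).symm.continuous)
  have hc2 : Continuous fun x : E3 => ((graphCoord Φ).symm x).2 :=
    continuous_snd.comp (graphCoord Φ).symm.continuous
  -- `D` and its boundary agree with the subgraph and the graph only on `U`, which is enough because
  -- the integrands vanish off the support of `f`.
  have h1 : ∫ x in D, fderiv ℝ f x v
      = ∫ x in {x | ((graphCoord Φ).symm x).2 < g ((graphCoord Φ).symm x).1}, fderiv ℝ f x v :=
    setIntegral_congr_of_ne_zero hD.measurableSet (isOpen_lt hc2 hc1).measurableSet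
      fun x hx => (hfU (fderiv_apply_ne_zero_mem_tsupport hx)).1
  have h2 : ∫ x in frontier D, f x * ⟪outerNormal D x, v⟫_ℝ ∂μHE[2]
      = ∫ x in {x | ((graphCoord Φ).symm x).2 = g ((graphCoord Φ).symm x).1},
          f x * ⟪outerNormal D x, v⟫_ℝ ∂μHE[2] :=
    setIntegral_congr_of_ne_zero isClosed_frontier.measurableSet
      (isClosed_eq hc2 hc1).measurableSet
      fun x hx => (hfU (subset_tsupport f (left_ne_zero_of_mul hx))).2.1
  rw [h1, h2, key]
  refine setIntegral_congr_fun (isClosed_eq hc2 hc1).measurableSet fun x hx => ?_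
  by_cases hfx : f x = 0
  · simp [hfx]
  · have hxU := hfU (subset_tsupport f hfx)
    change f x * _ = f x * _
    rw [hxU.2.2 (hxU.2.1.mpr hx)]

/-- Near `p` the boundary lies in the image of a unit disc under a Lipschitz graph map. -/
lemma euclideanHausdorffMeasure_finiteAtFilter_frontier {D : Set E3} (hD : IsOpen D) {p : E3}
    (hp : p ∈ frontier D) {ρ : E3 → ℝ} (h : IsDefiningFunctionAt D p ρ) :
    (μHE[2] : Measure E3).FiniteAtFilter (𝓝[frontier D] p) := by
  obtain ⟨Φ, g, hg, hgc, hev⟩ := exists_graph_chart hD hp h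
  obtain ⟨K, hK⟩ := hg.lipschitzWith_of_hasCompactSupport hgc (by simp)
  set C := graphCoord Φ with hC
  have hc1 : Continuous fun x : E3 => (C.symm x).1 := continuous_fst.comp C.symm.continuous
  have hb := hc1.continuousAt (x := p) (Metric.ball_mem_nhds _ one_pos)
  refine ⟨_, inter_mem (mem_nhdsWithin_of_mem_nhds (inter_mem hev hb)) self_mem_nhdsWithin, ?_⟩
  have hL : LipschitzWith (1 * (1 + K)) (Φ ∘ graphMap g) :=
    Φ.isometry.lipschitz.comp (lipschitzWith_graphMap hK)
  refine lt_of_le_of_lt (measure_mono (t := (Φ ∘ graphMap g) '' Metric.ball (C.symm p).1 1) ?_)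
    ((euclideanHausdorffMeasure_image_le hL.lipschitzOnWith 2).trans_lt ?_)
  · rintro x ⟨⟨hx, hx1⟩, hx2⟩
    refine ⟨(C.symm x).1, hx1, ?_⟩
    rw [Function.comp_apply, graphMap, ← hx.2.1.mp hx2, Prod.mk.eta, ← graphCoord_apply,
      ← hC, C.apply_symm_apply]
  · rw [EuclideanSpace.euclideanHausdorffMeasure_eq_volume]
    exact ENNReal.mul_lt_top (ENNReal.pow_lt_top ENNReal.coe_lt_top) measure_ball_lt_top

/-- The projection to the base plane is 1-Lipschitz and maps the patch onto a neighbourhood of the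
base point. This is what later turns vanishing almost everywhere into vanishing at `p`. -/
lemma euclideanHausdorffMeasure_frontier_inter_pos {D : Set E3} (hD : IsOpen D) {p : E3}
    (hp : p ∈ frontier D) {ρ : E3 → ℝ} (h : IsDefiningFunctionAt D p ρ) {W : Set E3}
    (hW : W ∈ 𝓝 p) : 0 < μHE[2] (frontier D ∩ W) := by
  obtain ⟨Φ, g, hg, hgc, hev⟩ := exists_graph_chart hD hp h
  set C := graphCoord Φ with hC
  have hgp := hev.self_of_nhds.2.1.mp hp
  have htend : Tendsto (fun y => C (y, g y)) (𝓝 (C.symm p).1) (𝓝 p) := by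
    have hc : Continuous fun y => C (y, g y) :=
      C.continuous.comp (continuous_id.prodMk hg.continuous)
    have := hc.tendsto (C.symm p).1
    rwa [← hgp, Prod.mk.eta, C.apply_symm_apply] at this
  have hN : {y | C (y, g y) ∈ frontier D ∩ W} ∈ 𝓝 (C.symm p).1 := by
    filter_upwards [htend.eventually hev, htend.eventually hW] with y h1 h2
    exact ⟨h1.2.1.mpr (by simp), h2⟩
  have hL : LipschitzWith 1 fun x : E3 => (C.symm x).1 := by
    refine LipschitzWith.of_dist_le_mul fun x y => ?_
    rw [NNReal.coe_one, one_mul, ← Φ.symm.dist_map x y, dist_eq_norm, dist_eq_norm]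
    exact WithLp.norm_fst_le _ (Φ.symm x - Φ.symm y)
  have hle := euclideanHausdorffMeasure_image_le (hL.lipschitzOnWith (s := frontier D ∩ W)) 2
  rw [ENNReal.coe_one, one_pow, one_mul,
    EuclideanSpace.euclideanHausdorffMeasure_eq_volume] at hle
  refine lt_of_lt_of_le (Measure.measure_pos_of_mem_nhds volume (x := (C.symm p).1) ?_) hle
  refine mem_of_superset hN fun y hy => ⟨_, hy, ?_⟩
  simp

namespace IsBoundedSmoothDomain

lemma isCompact_frontier {D : Set E3} (hD : IsBoundedSmoothDomain D) : IsCompact (frontier D) :=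
  hD.isBounded.isCompact_closure.of_isClosed_subset isClosed_frontier frontier_subset_closure

lemma euclideanHausdorffMeasure_frontier_lt_top {D : Set E3} (hD : IsBoundedSmoothDomain D) :
    μHE[2] (frontier D) < ⊤ := by
  refine hD.isCompact_frontier.measure_lt_top_of_nhdsWithin fun p hp => ?_
  obtain ⟨ρ, hρ⟩ := hD.smooth_boundary p hp
  exact euclideanHausdorffMeasure_finiteAtFilter_frontier hD.isOpen hp hρ

/-- Finite two-dimensional measure forces the three-dimensional measure to vanish. -/
lemma volume_frontier {D : Set E3} (hD : IsBoundedSmoothDomain D) : volume (frontier D) = 0 := by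
  have h := (Measure.euclideanHausdorffMeasure_zero_or_top (show 2 < 3 by norm_num)
    (frontier D)).resolve_right hD.euclideanHausdorffMeasure_frontier_lt_top.ne
  rwa [EuclideanSpace.euclideanHausdorffMeasure_eq_volume] at h

lemma continuousOn_outerNormal {D : Set E3} (hD : IsBoundedSmoothDomain D) :
    ContinuousOn (outerNormal D) (frontier D) := by
  intro p hp
  obtain ⟨ρ, hρ⟩ := hD.smooth_boundary p hp
  have hc : Continuous (gradient ρ) :=
    (InnerProductSpace.toDual ℝ E3).symm.continuous.comp (hρ.smooth.continuous_fderiv (by simp))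
  have hcp : ContinuousAt (fun x => ‖gradient ρ x‖⁻¹ • gradient ρ x) p :=
    (hc.norm.continuousAt.inv₀ (norm_ne_zero_iff.mpr hρ.gradient_ne_zero)).smul hc.continuousAt
  refine hcp.continuousWithinAt.congr_of_eventuallyEq ?_ (outerNormal_eq hD.isOpen hp hρ)
  filter_upwards [mem_nhdsWithin_of_mem_nhds hρ.eventually, self_mem_nhdsWithin] with x h1 h2
  exact outerNormal_eq hD.isOpen h2 h1

lemma norm_outerNormal {D : Set E3} (hD : IsBoundedSmoothDomain D) {x : E3}
    (hx : x ∈ frontier D) : ‖outerNormal D x‖ = 1 := by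
  obtain ⟨ρ, hρ⟩ := hD.smooth_boundary x hx
  rw [outerNormal_eq hD.isOpen hx hρ, norm_smul, norm_inv, norm_norm]
  exact inv_mul_cancel₀ (norm_ne_zero_iff.mpr hρ.gradient_ne_zero)

lemma integrableOn_frontier {D : Set E3} (hD : IsBoundedSmoothDomain D) {f : E3 → ℝ}
    (hf : ContinuousOn f (frontier D)) : IntegrableOn f (frontier D) μHE[2] := by
  obtain ⟨M, hM⟩ := hD.isCompact_frontier.exists_bound_of_continuousOn hf
  have hm : MeasurableSet (frontier D) := isClosed_frontier.measurableSet
  have : IsFiniteMeasure ((μHE[2] : Measure E3).restrict (frontier D)) :=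
    ⟨by simpa using hD.euclideanHausdorffMeasure_frontier_lt_top⟩
  exact Integrable.of_bound (hf.aestronglyMeasurable hm) M
    ((ae_restrict_iff' hm).mpr (Eventually.of_forall hM))

end IsBoundedSmoothDomain

/-- The integral of a derivative over the exterior of `D` is opposite to the one over `D`. -/
lemma setIntegral_exterior_fderiv {Ω D : Set E3} (hΩ : IsOpen Ω) (hD : IsBoundedSmoothDomain D)
    {f : E3 → ℝ} (hf : ContDiff ℝ 1 f) (hfc : HasCompactSupport f) (hfΩ : tsupport f ⊆ Ω) (v : E3) :
    ∫ x in Ω \ closure D, fderiv ℝ f x v = -∫ x in D, fderiv ℝ f x v := by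
  have hi : Integrable (fun x => fderiv ℝ f x v) :=
    Continuous.integrable_of_hasCompactSupport
      ((hf.continuous_fderiv (by simp)).clm_apply continuous_const) (hfc.fderiv_apply ℝ v)
  have h1 : ∫ x in Ω \ closure D, fderiv ℝ f x v = ∫ x in (closure D)ᶜ, fderiv ℝ f x v :=
    setIntegral_congr_of_ne_zero (hΩ.measurableSet.diff isClosed_closure.measurableSet)
      isClosed_closure.measurableSet.compl fun x hx => by
        simp [hfΩ (fderiv_apply_ne_zero_mem_tsupport hx)]
  have h2 : ((closure D)ᶜ : Set E3) =ᵐ[volume] (Dᶜ : Set E3) := by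
    have : (closure D : Set E3) =ᵐ[volume] D := by
      rw [closure_eq_self_union_frontier]
      exact union_ae_eq_left_of_ae_eq_empty (ae_eq_empty.mpr hD.volume_frontier)
    exact this.compl
  rw [h1, setIntegral_congr_set h2, eq_neg_iff_add_eq_zero, add_comm,
    integral_add_compl hD.isOpen.measurableSet hi, integral_fderiv_apply_eq_zero hf hfc]

/-! ### Surface divergence theorem. -/

lemma contDiff_gradient {f : E3 → ℝ} (hf : ContDiff ℝ ∞ f) : ContDiff ℝ ∞ (gradient f) :=
  (InnerProductSpace.toDual ℝ E3).symm.contDiff.comp (hf.fderiv_right (by simp))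

/-- The normalized gradient, which extends the outer normal. -/
def unitGradient (ρ : E3 → ℝ) (x : E3) : E3 := ‖gradient ρ x‖⁻¹ • gradient ρ x

namespace IsDefiningFunctionAt

variable {D : Set E3} {p : E3} {ρ : E3 → ℝ}

lemma contDiffAt_unitGradient (h : IsDefiningFunctionAt D p ρ) :
    ContDiffAt ℝ ∞ (unitGradient ρ) p := by
  have hg := (contDiff_gradient h.smooth).contDiffAt (x := p)
  exact ((hg.norm ℝ h.gradient_ne_zero).inv (norm_ne_zero_iff.mpr h.gradient_ne_zero)).smul hg

lemma norm_unitGradient (h : IsDefiningFunctionAt D p ρ) : ‖unitGradient ρ p‖ = 1 := by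
  rw [unitGradient, norm_smul, norm_inv, norm_norm]
  exact inv_mul_cancel₀ (norm_ne_zero_iff.mpr h.gradient_ne_zero)

/-- The extension has norm `1` in a full neighbourhood of `p`, so this holds for every direction
`v`, tangential or not. -/
lemma inner_fderiv_unitGradient (h : IsDefiningFunctionAt D p ρ) (v : E3) :
    ⟪unitGradient ρ p, fderiv ℝ (unitGradient ρ) p v⟫_ℝ = 0 := by
  have hd := ((h.contDiffAt_unitGradient.differentiableAt (by simp)).hasFDerivAt.norm_sq)
  have h1 : (fun x => ‖unitGradient ρ x‖ ^ 2) =ᶠ[𝓝 p] fun _ => 1 := by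
    filter_upwards [h.eventually] with x hx
    rw [hx.norm_unitGradient, one_pow]
  have h2 := hd.unique ((hasFDerivAt_const (1 : ℝ) p).congr_of_eventuallyEq h1)
  simpa using DFunLike.congr_fun h2 v

end IsDefiningFunctionAt

/-- The surface divergence of the field `W` on space, for a surface with unit normal `ν` at `x`. -/
def tangentialDiv (ν : E3) (W : E3 → E3) (x : E3) : ℝ :=
  ∑ i : Fin 3, ((fderiv ℝ W x (EuclideanSpace.single i 1)) i - ν i * (fderiv ℝ W x ν) i)

lemma hasFDerivAt_coord {N : E3 → E3} {x : E3} (hN : DifferentiableAt ℝ N x) (i : Fin 3) :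
    HasFDerivAt (fun y => N y i) ((EuclideanSpace.proj i).comp (fderiv ℝ N x)) x :=
  ((EuclideanSpace.proj i : E3 →L[ℝ] ℝ)).hasFDerivAt.comp x hN.hasFDerivAt

lemma fderiv_coord_mul_coord {N W : E3 → E3} {x : E3} (hN : DifferentiableAt ℝ N x)
    (hW : DifferentiableAt ℝ W x) (i j : Fin 3) (v : E3) :
    fderiv ℝ (fun y => N y i * W y j) x v
      = N x i * (fderiv ℝ W x v) j + W x j * (fderiv ℝ N x v) i := by
  have h : HasFDerivAt (fun y => N y i * W y j) _ x :=
    (hasFDerivAt_coord hN i).mul (hasFDerivAt_coord hW j)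
  rw [h.fderiv]
  simp

lemma map_eq_sum_coord (L : E3 →L[ℝ] E3) (ν : E3) (j : Fin 3) :
    (L ν) j = ∑ i, ν i * (L (EuclideanSpace.single i 1)) j := by
  have hν : ν = ∑ i, ν i • EuclideanSpace.single i (1 : ℝ) := by
    ext k
    simp [Pi.single_apply]
  conv_lhs => rw [hν]
  simp

/-- The surface divergence of a tangential field, as a sum of tangential derivatives. -/
lemma IsDefiningFunctionAt.sum_tangential_eq {D : Set E3} {x : E3} {ρ : E3 → ℝ}
    (h : IsDefiningFunctionAt D x ρ) {W : E3 → E3} (hW : DifferentiableAt ℝ W x)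
    (hWx : ⟪unitGradient ρ x, W x⟫_ℝ = 0) :
    ∑ i : Fin 3, ∑ j : Fin 3,
      (unitGradient ρ x i
          * fderiv ℝ (fun y => unitGradient ρ y i * W y j) x (EuclideanSpace.single j 1)
        - unitGradient ρ x j
          * fderiv ℝ (fun y => unitGradient ρ y i * W y j) x (EuclideanSpace.single i 1))
      = tangentialDiv (unitGradient ρ x) W x := by
  have hN := h.contDiffAt_unitGradient.differentiableAt (by simp)
  simp only [fderiv_coord_mul_coord hN hW, tangentialDiv, map_eq_sum_coord _ (unitGradient ρ x)]
  have hn := h.norm_unitGradient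
  have hn2 : ∑ i, unitGradient ρ x i ^ 2 = 1 := by
    have := EuclideanSpace.real_norm_sq_eq (unitGradient ρ x)
    rw [hn] at this
    linarith
  have hdn (j : Fin 3) := h.inner_fderiv_unitGradient (EuclideanSpace.single j 1)
  simp only [PiLp.inner_apply, Fin.sum_univ_three, RCLike.inner_apply, conj_trivial] at *
  have h0 := hdn 0
  have h1 := hdn 1
  have h2 := hdn 2
  set N := unitGradient ρ x
  set A := fun i => fderiv ℝ (unitGradient ρ) x (EuclideanSpace.single i 1)
  set B := fun i => fderiv ℝ W x (EuclideanSpace.single i 1)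
  change A 0 0 * N 0 + A 0 1 * N 1 + A 0 2 * N 2 = 0 at h0
  change A 1 0 * N 0 + A 1 1 * N 1 + A 1 2 * N 2 = 0 at h1
  change A 2 0 * N 0 + A 2 1 * N 1 + A 2 2 * N 2 = 0 at h2
  change (_ : ℝ) = B 0 0 - N 0 * (N 0 * B 0 0 + N 1 * B 1 0 + N 2 * B 2 0)
      + (B 1 1 - N 1 * (N 0 * B 0 1 + N 1 * B 1 1 + N 2 * B 2 1))
      + (B 2 2 - N 2 * (N 0 * B 0 2 + N 1 * B 1 2 + N 2 * B 2 2))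
  -- The double sum is `|N|² div W + ∑ Wⱼ (N · ∂ⱼN) - ∑ Nⱼ (N · ∇)Wⱼ - (N · W) div N`. Here `|N| =
  -- 1`, and the second and last terms vanish.
  linear_combination W x 0 * h0 + W x 1 * h1 + W x 2 * h2 + (B 0 0 + B 1 1 + B 2 2) * hn2
    - (A 0 0 + A 1 1 + A 2 2) * hWx

/-- Tangential derivatives integrate to zero. -/
lemma setIntegral_tangential_eq_zero {D U : Set E3} (hD : IsBoundedSmoothDomain D)
    (hU : ∀ f : E3 → ℝ, ContDiff ℝ 1 f → HasCompactSupport f → tsupport f ⊆ U → ∀ v : E3,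
      ∫ x in D, fderiv ℝ f x v
        = ∫ x in frontier D, f x * ⟪outerNormal D x, v⟫_ℝ ∂μHE[2])
    {G : E3 → ℝ} (hG : ContDiff ℝ 2 G) (hGc : HasCompactSupport G) (hGU : tsupport G ⊆ U)
    (u v : E3) :
    ∫ x in frontier D, (⟪outerNormal D x, u⟫_ℝ * fderiv ℝ G x v
      - ⟪outerNormal D x, v⟫_ℝ * fderiv ℝ G x u) ∂μHE[2] = 0 := by
  have hd (w : E3) : ContDiff ℝ 1 fun x => fderiv ℝ G x w :=
    (hG.fderiv_right (by norm_num)).clm_apply contDiff_const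
  -- The second derivatives `∂_u ∂_v G` and `∂_v ∂_u G` have equal integrals over `D`; the
  -- divergence theorem rewrites both as boundary integrals.
  have key (w z : E3) := hU _ (hd w) (hGc.fderiv_apply ℝ w)
    ((tsupport_fderiv_apply_subset ℝ w).trans hGU) z
  have hi (w z : E3) : IntegrableOn
      (fun x => ⟪outerNormal D x, z⟫_ℝ * fderiv ℝ G x w) (frontier D) μHE[2] :=
    hD.integrableOn_frontier ((hD.continuousOn_outerNormal.inner continuousOn_const).mul
      (hd w).continuous.continuousOn)
  rw [integral_sub (hi v u) (hi u v), sub_eq_zero]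
  simp only [mul_comm ⟪_, _⟫_ℝ]
  rw [← key v u, ← key u v]
  congr 1 with x
  have hdd (w z : E3) : fderiv ℝ (fun y => fderiv ℝ G y w) x z
      = fderiv ℝ (fderiv ℝ G) x z w := by
    have := ((hG.fderiv_right (m := 1) (by norm_num)).differentiable (by simp) x).hasFDerivAt
    rw [(this.clm_apply (hasFDerivAt_const w x)).fderiv]
    simp
  rw [hdd, hdd]
  exact (hG.contDiffAt.isSymmSndFDerivAt (by simp)).eq _ _

/-- The surface divergence theorem for compactly supported tangential fields. -/
theorem setIntegral_tangentialDiv_eq_zero {D U : Set E3} (hD : IsBoundedSmoothDomain D)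
    (hU : ∀ f : E3 → ℝ, ContDiff ℝ 1 f → HasCompactSupport f → tsupport f ⊆ U → ∀ v : E3,
      ∫ x in D, fderiv ℝ f x v
        = ∫ x in frontier D, f x * ⟪outerNormal D x, v⟫_ℝ ∂μHE[2])
    {ρ : E3 → ℝ} (hρ : ∀ x ∈ U, IsDefiningFunctionAt D x ρ) {W : E3 → E3} (hW : ContDiff ℝ 2 W)
    (hWc : HasCompactSupport W) (hWU : tsupport W ⊆ U)
    (hWt : ∀ x ∈ frontier D, ⟪outerNormal D x, W x⟫_ℝ = 0) :
    ∫ x in frontier D, tangentialDiv (outerNormal D x) W x ∂μHE[2] = 0 := by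
  -- The normal is replaced by its extension `unitGradient ρ`, which is smooth on `U`. As `W`
  -- vanishes outside, the products are `C²` on all of space.
  set G : Fin 3 → Fin 3 → E3 → ℝ := fun i j y => unitGradient ρ y i * W y j with hGdef
  have hsupp (i j : Fin 3) : Function.support (G i j) ⊆ Function.support W := by
    intro x hx hWx
    exact hx (by simp [hGdef, hWx])
  have htsupp (i j : Fin 3) : tsupport (G i j) ⊆ tsupport W := closure_mono (hsupp i j)
  have hGc (i j : Fin 3) : HasCompactSupport (G i j) := hWc.mono (hsupp i j)
  have hG (i j : Fin 3) : ContDiff ℝ 2 (G i j) := by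
    rw [contDiff_iff_contDiffAt]
    intro x
    by_cases hx : x ∈ tsupport W
    · have h1 := ((hρ x (hWU hx)).contDiffAt_unitGradient).of_le
        (show (2 : WithTop ℕ∞) ≤ ∞ from
          WithTop.coe_le_coe.mpr (le_top : (2 : ℕ∞) ≤ ⊤))
      exact (contDiffAt_euclidean.mp h1 i).mul (contDiffAt_euclidean.mp hW.contDiffAt j)
    · refine (contDiffAt_const (c := (0 : ℝ))).congr_of_eventuallyEq ?_
      exact notMem_tsupport_iff_eventuallyEq.mp fun h => hx (htsupp i j h)
  have hzero (i j : Fin 3) := setIntegral_tangential_eq_zero hD hU (hG i j) (hGc i j)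
    ((htsupp i j).trans hWU) (EuclideanSpace.single i 1) (EuclideanSpace.single j 1)
  have hint (i j : Fin 3) : IntegrableOn (fun x =>
      ⟪outerNormal D x, EuclideanSpace.single i 1⟫_ℝ
          * fderiv ℝ (G i j) x (EuclideanSpace.single j 1)
        - ⟪outerNormal D x, EuclideanSpace.single j 1⟫_ℝ
          * fderiv ℝ (G i j) x (EuclideanSpace.single i 1)) (frontier D) μHE[2] := by
    have hd (w : E3) : Continuous fun x => fderiv ℝ (G i j) x w :=
      ((hG i j).continuous_fderiv (by simp)).clm_apply continuous_const
    have hn (w : E3) := hD.continuousOn_outerNormal.inner (𝕜 := ℝ)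
      (continuousOn_const (c := w))
    exact hD.integrableOn_frontier
      (((hn _).mul (hd _).continuousOn).sub ((hn _).mul (hd _).continuousOn))
  have hsum : ∫ x in frontier D, (∑ i : Fin 3, ∑ j : Fin 3,
      (⟪outerNormal D x, EuclideanSpace.single i 1⟫_ℝ
          * fderiv ℝ (G i j) x (EuclideanSpace.single j 1)
        - ⟪outerNormal D x, EuclideanSpace.single j 1⟫_ℝ
          * fderiv ℝ (G i j) x (EuclideanSpace.single i 1))) ∂μHE[2] = 0 := by
    rw [integral_finsetSum _ fun i _ => integrable_finsetSum _ fun j _ => hint i j]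
    refine Finset.sum_eq_zero fun i _ => ?_
    rw [integral_finsetSum _ fun j _ => hint i j]
    exact Finset.sum_eq_zero fun j _ => hzero i j
  rw [← hsum]
  refine setIntegral_congr_fun isClosed_frontier.measurableSet fun x hx => ?_
  simp only [EuclideanSpace.inner_single_right, conj_trivial, one_mul]
  by_cases hxW : x ∈ tsupport W
  · have hdef := hρ x (hWU hxW)
    have hn : outerNormal D x = unitGradient ρ x := outerNormal_eq hD.isOpen hx hdef
    rw [hn, ← hdef.sum_tangential_eq (hW.differentiable (by simp) x) (by rw [← hn]; exact hWt x hx)]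
  · have h1 : fderiv ℝ W x = 0 := fderiv_of_notMem_tsupport ℝ hxW
    have h2 (i j : Fin 3) : fderiv ℝ (G i j) x = 0 :=
      fderiv_of_notMem_tsupport ℝ fun h => hxW (htsupp i j h)
    simp [tangentialDiv, h1, h2]

/-! ### Integration by parts and the bulk Euler-Lagrange equation. -/

lemma fderiv_smul_apply_coord {ψ : E3 → ℝ} {Y : E3 → E3} {x : E3} (hψ : DifferentiableAt ℝ ψ x)
    (hY : DifferentiableAt ℝ Y x) (v : E3) (i : Fin 3) :
    (fderiv ℝ (fun y => ψ y • Y y) x v) i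
      = ψ x * (fderiv ℝ Y x v) i + fderiv ℝ ψ x v * Y x i := by
  have h : HasFDerivAt (fun y => ψ y • Y y) _ x := hψ.hasFDerivAt.smul hY.hasFDerivAt
  rw [h.fderiv]
  simp

lemma apply_eq_sum_coord (L : E3 →L[ℝ] ℝ) (w : E3) :
    L w = ∑ i, L (EuclideanSpace.single i 1) * w i := by
  have hw : w = ∑ i, w i • EuclideanSpace.single i (1 : ℝ) := by
    ext k
    simp [Pi.single_apply]
  conv_lhs => rw [hw]
  simp [mul_comm]

/-- The normal derivative of `ψ` enters multiplied by `ν · Y`, which is zero; so the full derivative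
of `ψ` along `Y` appears. -/
lemma tangentialDiv_smul {ψ : E3 → ℝ} {Y : E3 → E3} {x ν : E3} (hψ : DifferentiableAt ℝ ψ x)
    (hY : DifferentiableAt ℝ Y x) (hν : ⟪ν, Y x⟫_ℝ = 0) :
    tangentialDiv ν (fun y => ψ y • Y y) x = ψ x * tangentialDiv ν Y x + fderiv ℝ ψ x (Y x) := by
  simp only [tangentialDiv, fderiv_smul_apply_coord hψ hY, apply_eq_sum_coord (fderiv ℝ ψ x) (Y x),
    PiLp.inner_apply, Fin.sum_univ_three, RCLike.inner_apply, conj_trivial] at *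
  linear_combination (-fderiv ℝ ψ x ν) * hν

lemma divergence_smul {ψ : E3 → ℝ} {Y : E3 → E3} {x : E3} (hψ : DifferentiableAt ℝ ψ x)
    (hY : DifferentiableAt ℝ Y x) :
    divergence (fun y => ψ y • Y y) x = ψ x * divergence Y x + fderiv ℝ ψ x (Y x) := by
  simp only [divergence, fderiv_smul_apply_coord hψ hY, apply_eq_sum_coord (fderiv ℝ ψ x) (Y x),
    Finset.sum_add_distrib, Finset.mul_sum]

/-- Integration by parts on a closed surface, for test functions supported near a point. -/
theorem setIntegral_mul_tangentialDiv_add {D U : Set E3} (hD : IsBoundedSmoothDomain D)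
    (hU : ∀ f : E3 → ℝ, ContDiff ℝ 1 f → HasCompactSupport f → tsupport f ⊆ U → ∀ v : E3,
      ∫ x in D, fderiv ℝ f x v
        = ∫ x in frontier D, f x * ⟪outerNormal D x, v⟫_ℝ ∂μHE[2])
    {ρ : E3 → ℝ} (hρ : ∀ x ∈ U, IsDefiningFunctionAt D x ρ) {Y : E3 → E3}
    (hY : ∀ x ∈ U, ContDiffAt ℝ 2 Y x)
    (hYt : ∀ x ∈ frontier D ∩ U, ⟪outerNormal D x, Y x⟫_ℝ = 0) {ψ : E3 → ℝ}
    (hψ : ContDiff ℝ 2 ψ) (hψc : HasCompactSupport ψ) (hψU : tsupport ψ ⊆ U) :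
    ∫ x in frontier D, (ψ x * tangentialDiv (outerNormal D x) Y x + fderiv ℝ ψ x (Y x)) ∂μHE[2]
      = 0 := by
  have hsupp : Function.support (fun y => ψ y • Y y) ⊆ Function.support ψ :=
    Function.support_smul_subset_left ψ Y
  have htsupp : tsupport (fun y => ψ y • Y y) ⊆ tsupport ψ := closure_mono hsupp
  have hW : ContDiff ℝ 2 fun y => ψ y • Y y := by
    rw [contDiff_iff_contDiffAt]
    intro x
    by_cases hx : x ∈ tsupport ψ
    · exact hψ.contDiffAt.smul (hY x (hψU hx))
    · refine (contDiffAt_const (c := (0 : E3))).congr_of_eventuallyEq ?_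
      exact notMem_tsupport_iff_eventuallyEq.mp fun h => hx (htsupp h)
  rw [← setIntegral_tangentialDiv_eq_zero hD hU hρ hW (hψc.mono hsupp) (htsupp.trans hψU)]
  · refine setIntegral_congr_fun isClosed_frontier.measurableSet fun x hx => ?_
    by_cases hxψ : x ∈ tsupport ψ
    · exact (tangentialDiv_smul (hψ.differentiable (by simp) x)
        ((hY x (hψU hxψ)).differentiableAt (by simp)) (hYt x ⟨hx, hψU hxψ⟩)).symm
    · have h1 : fderiv ℝ (fun y => ψ y • Y y) x = 0 :=
        fderiv_of_notMem_tsupport ℝ fun h => hxψ (htsupp h)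
      simp [tangentialDiv, h1, fderiv_of_notMem_tsupport ℝ hxψ, image_eq_zero_of_notMem_tsupport hxψ]
  · intro x hx
    by_cases hxψ : x ∈ tsupport ψ
    · rw [real_inner_smul_right, hYt x ⟨hx, hψU hxψ⟩, mul_zero]
    · simp [image_eq_zero_of_notMem_tsupport hxψ]

/-- A divergence theorem for constant directions implies the one for vector fields. -/
lemma integral_divergence_smul {μ ν : Measure E3} [IsFiniteMeasureOnCompacts μ] {n : E3 → E3}
    {U : Set E3} (hν : ∀ f : E3 → ℝ, Continuous f → ∀ v, Integrable (fun x => f x * ⟪n x, v⟫_ℝ) ν)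
    (hU : ∀ f : E3 → ℝ, ContDiff ℝ 1 f → HasCompactSupport f → tsupport f ⊆ U → ∀ v : E3,
      ∫ x, fderiv ℝ f x v ∂μ = ∫ x, f x * ⟪n x, v⟫_ℝ ∂ν)
    {ψ : E3 → ℝ} {Y : E3 → E3} (hψ : ContDiff ℝ 1 ψ) (hψc : HasCompactSupport ψ)
    (hψU : tsupport ψ ⊆ U) (hY : ContDiff ℝ 1 Y) :
    ∫ x, (ψ x * divergence Y x + fderiv ℝ ψ x (Y x)) ∂μ = ∫ x, ψ x * ⟪n x, Y x⟫_ℝ ∂ν := by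
  set W : E3 → E3 := fun y => ψ y • Y y with hWdef
  have hW : ContDiff ℝ 1 W := hψ.smul hY
  have hWi (i : Fin 3) : ContDiff ℝ 1 fun y => W y i := contDiff_euclidean.mp hW i
  have hsupp (i : Fin 3) : Function.support (fun y => W y i) ⊆ Function.support ψ := by
    intro x hx hψx
    exact hx (by simp [hWdef, hψx])
  have hWc (i : Fin 3) : HasCompactSupport fun y => W y i := hψc.mono (hsupp i)
  have key (i : Fin 3) := hU _ (hWi i) (hWc i) ((closure_mono (hsupp i)).trans hψU)
    (EuclideanSpace.single i 1)
  have hdiv : ∀ x, ψ x * divergence Y x + fderiv ℝ ψ x (Y x)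
      = ∑ i, fderiv ℝ (fun y => W y i) x (EuclideanSpace.single i 1) := by
    intro x
    rw [← divergence_smul (hψ.differentiable (by simp) x) (hY.differentiable (by simp) x)]
    refine Finset.sum_congr rfl fun i _ => ?_
    rw [(hasFDerivAt_coord (hW.differentiable (by simp) x) i).fderiv]
    rfl
  have hin : ∀ x, ψ x * ⟪n x, Y x⟫_ℝ
      = ∑ i, W x i * ⟪n x, EuclideanSpace.single i (1 : ℝ)⟫_ℝ := by
    intro x
    simp [hWdef, PiLp.inner_apply, Finset.mul_sum, mul_assoc]
  simp only [hdiv, hin]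
  rw [integral_finsetSum, integral_finsetSum]
  · exact Finset.sum_congr rfl fun i _ => key i
  · exact fun i _ => hν _ (hWi i).continuous _
  · intro i _
    exact Continuous.integrable_of_hasCompactSupport
      (((hWi i).continuous_fderiv (by simp)).clm_apply continuous_const) ((hWc i).fderiv_apply ℝ _)

lemma divergence_continuous {Y : E3 → E3} (hY : ContDiff ℝ 1 Y) : Continuous (divergence Y) := by
  unfold divergence
  refine continuous_finsetSum _ fun i _ => ?_
  have : Continuous fun x => fderiv ℝ Y x (EuclideanSpace.single i 1) :=
    (hY.continuous_fderiv (by simp)).clm_apply continuous_const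
  exact (EuclideanSpace.proj i : E3 →L[ℝ] ℝ).continuous.comp this

/-- The Euler-Lagrange equation in an open set. -/
theorem eq_divergence_of_forall_integral {O : Set E3} (hO : IsOpen O) {Y : E3 → E3}
    (hY : ContDiff ℝ 1 Y) {Q : E3 → ℝ} (hQ : Continuous Q)
    (h : ∀ ψ : E3 → ℝ, ContDiff ℝ ∞ ψ → HasCompactSupport ψ → tsupport ψ ⊆ O →
      -∫ x in O, fderiv ℝ ψ x (Y x) = ∫ x in O, Q x * ψ x) :
    ∀ x ∈ O, Q x = divergence Y x := by
  have hdiv := divergence_continuous hY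
  have hae := hO.ae_eq_zero_of_integral_contDiff_smul_eq_zero (μ := volume)
    (f := fun x => Q x - divergence Y x)
    ((hQ.sub hdiv).locallyIntegrable.locallyIntegrableOn O) (by
      intro ψ hψ hψc hψO
      have hψ1 : ContDiff ℝ 1 ψ := hψ.of_le (by simp)
      -- The choice `ν = 0` removes the boundary term: compactly supported derivatives integrate to
      -- zero over the whole space.
      have hd := integral_divergence_smul (μ := volume) (ν := 0) (n := 0) (U := univ) (by simp)
        (fun f hf hfc _ v => by simpa using integral_fderiv_apply_eq_zero hf hfc v)
        hψ1 hψc (subset_univ _) hY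
      simp only [integral_zero_measure] at hd
      have hi1 : Integrable fun x => ψ x * divergence Y x :=
        (hψ.continuous.mul hdiv).integrable_of_hasCompactSupport hψc.mul_right
      have hi2 : Integrable fun x => fderiv ℝ ψ x (Y x) := by
        refine ((hψ1.continuous_fderiv (by simp)).clm_apply
          hY.continuous).integrable_of_hasCompactSupport ?_
        exact (hψc.fderiv ℝ).mono fun x hx h0 => hx (by simp [h0])
      have hi3 : Integrable fun x => Q x * ψ x :=
        (hQ.mul hψ.continuous).integrable_of_hasCompactSupport hψc.mul_left
      rw [integral_add hi1 hi2] at hd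
      have h1 : ∫ x in O, fderiv ℝ ψ x (Y x) = ∫ x, fderiv ℝ ψ x (Y x) :=
        setIntegral_eq_integral_of_forall_compl_eq_zero fun x hx => by
          rw [fderiv_of_notMem_tsupport ℝ fun h => hx (hψO h)]; rfl
      have h2 : ∫ x in O, Q x * ψ x = ∫ x, Q x * ψ x :=
        setIntegral_eq_integral_of_forall_compl_eq_zero fun x hx => by
          rw [image_eq_zero_of_notMem_tsupport fun h => hx (hψO h), mul_zero]
      have h3 := h ψ hψ hψc hψO
      rw [h1, h2] at h3
      have h4 : ∀ x, ψ x • (Q x - divergence Y x) = Q x * ψ x - ψ x * divergence Y x := by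
        intro x; rw [smul_eq_mul]; ring
      simp only [h4]
      rw [integral_sub hi3 hi1]
      linarith)
  have hEq := Measure.eqOn_open_of_ae_eq (μ := volume) (U := O) (f := Q) (g := divergence Y)
    (by
      rw [EventuallyEq, ae_restrict_iff' hO.measurableSet]
      filter_upwards [hae] with x hx hxO using sub_eq_zero.mp (hx hxO))
    hO hQ.continuousOn hdiv.continuousOn
  exact hEq

/-! ### First variation of the energy. -/

lemma hasDerivAt_integral_quadratic {X : Type*} [MeasurableSpace X] {μ : Measure X} {k : X → ℝ}
    {a b : X → E3} (h1 : Integrable (fun x => -(k x / 2) * ‖a x‖ ^ 2) μ)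
    (h2 : Integrable (fun x => k x * ⟪a x, b x⟫_ℝ) μ)
    (h3 : Integrable (fun x => -(k x / 2) * ‖b x‖ ^ 2) μ) :
    HasDerivAt (fun ε : ℝ => ∫ x, -(k x / 2) * ‖a x + ε • b x‖ ^ 2 ∂μ)
      (-∫ x, k x * ⟪a x, b x⟫_ℝ ∂μ) 0 := by
  -- The integral is a quadratic polynomial in `ε`, so no differentiation under the integral sign is
  -- needed.
  have heq : (fun ε : ℝ => ∫ x, -(k x / 2) * ‖a x + ε • b x‖ ^ 2 ∂μ)
      = fun ε : ℝ => (∫ x, -(k x / 2) * ‖a x‖ ^ 2 ∂μ) - ε * (∫ x, k x * ⟪a x, b x⟫_ℝ ∂μ)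
        + ε ^ 2 * ∫ x, -(k x / 2) * ‖b x‖ ^ 2 ∂μ := by
    funext ε
    have h12 : Integrable (fun x => -(k x / 2) * ‖a x‖ ^ 2 - ε * (k x * ⟪a x, b x⟫_ℝ)) μ :=
      h1.sub (h2.const_mul ε)
    rw [← integral_const_mul, ← integral_const_mul, ← integral_sub h1 (h2.const_mul ε),
      ← integral_add h12 (h3.const_mul (ε ^ 2))]
    congr 1 with x
    rw [norm_add_sq_real, real_inner_smul_right, norm_smul, mul_pow, Real.norm_eq_abs, sq_abs]
    ring
  rw [heq]
  have hd : HasDerivAt (fun ε : ℝ => (∫ x, -(k x / 2) * ‖a x‖ ^ 2 ∂μ)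
      - ε * (∫ x, k x * ⟪a x, b x⟫_ℝ ∂μ) + ε ^ 2 * ∫ x, -(k x / 2) * ‖b x‖ ^ 2 ∂μ) _ 0 :=
    (((hasDerivAt_id (0 : ℝ)).mul_const _).const_sub _).add
      (((hasDerivAt_id (0 : ℝ)).pow 2).mul_const _)
  convert hd using 1
  simp

lemma gradient_add_mul {θ ψ : E3 → ℝ} (hθ : ContDiff ℝ ∞ θ) (hψ : ContDiff ℝ ∞ ψ) (ε : ℝ) (x : E3) :
    gradient (fun y => θ y + ε * ψ y) x = gradient θ x + ε • gradient ψ x := by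
  have h : HasFDerivAt (fun y => θ y + ε * ψ y) (fderiv ℝ θ x + ε • fderiv ℝ ψ x) x :=
    (hθ.differentiable (by simp) x).hasFDerivAt.add
      ((hψ.differentiable (by simp) x).hasFDerivAt.const_mul ε)
  simp only [gradient, h.fderiv, map_add, map_smulₛₗ]
  simp

lemma surfGrad_add_mul {n : E3 → E3} {θ ψ : E3 → ℝ} (hθ : ContDiff ℝ ∞ θ) (hψ : ContDiff ℝ ∞ ψ)
    (ε : ℝ) (x : E3) :
    surfGrad n (fun y => θ y + ε * ψ y) x = surfGrad n θ x + ε • surfGrad n ψ x := by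
  simp only [surfGrad, tangentProj, gradient_add_mul hθ hψ, inner_add_right, real_inner_smul_right,
    smul_sub, add_smul, smul_smul]
  abel

/-- The projection is symmetric and idempotent. Hence `∇_Γ θ · ∇_Γ ψ` is the full derivative of `ψ`
along `∇_Γ θ`, the form in which integration by parts produces it. -/
lemma inner_tangentProj_tangentProj {n : E3 → E3} {x : E3} (hn : ‖n x‖ = 1) (v w : E3) :
    ⟪tangentProj n x v, tangentProj n x w⟫_ℝ = ⟪tangentProj n x v, w⟫_ℝ := by
  have h : ⟪n x, n x⟫_ℝ = 1 := by rw [real_inner_self_eq_norm_sq, hn, one_pow]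
  simp only [tangentProj, inner_sub_left, inner_sub_right, real_inner_smul_left,
    real_inner_smul_right, h]
  rw [real_inner_comm (n x) v]
  ring

lemma inner_tangentProj_left {n : E3 → E3} {x : E3} (hn : ‖n x‖ = 1) (v : E3) :
    ⟪n x, tangentProj n x v⟫_ℝ = 0 := by
  rw [tangentProj, inner_sub_right, real_inner_smul_right, real_inner_self_eq_norm_sq, hn]
  ring

lemma inner_gradient_left {f : E3 → ℝ} {x v : E3} : ⟪gradient f x, v⟫_ℝ = fderiv ℝ f x v := by
  simp [gradient]

lemma continuous_gradient {f : E3 → ℝ} (hf : ContDiff ℝ ∞ f) : Continuous (gradient f) :=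
  (contDiff_gradient hf).continuous

lemma IsBoundedSmoothDomain.continuousOn_surfGrad {D : Set E3} (hD : IsBoundedSmoothDomain D)
    {f : E3 → ℝ} (hf : ContDiff ℝ ∞ f) :
    ContinuousOn (surfGrad (outerNormal D) f) (frontier D) := by
  have hg := (continuous_gradient hf).continuousOn (s := frontier D)
  have hn := hD.continuousOn_outerNormal
  exact hg.sub ((hn.inner (𝕜 := ℝ) hg).smul hn)

lemma integrableOn_of_isBounded {S : Set E3} (hS : Bornology.IsBounded S) {f : E3 → ℝ}
    (hf : Continuous f) : IntegrableOn f S :=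
  (hf.continuousOn.integrableOn_compact hS.isCompact_closure).mono_set subset_closure

/-- The first variation of the energy. -/
lemma hasDerivAt_thermalEnergy {ΩA ΩB : Set E3} (hA : IsBoundedSmoothDomain ΩA)
    (hB : Bornology.IsBounded ΩB) {κA κB κS θA θB θS ψA ψB ψS : E3 → ℝ}
    (hκA : Continuous κA) (hκB : Continuous κB) (hκS : Continuous κS)
    (hθA : ContDiff ℝ ∞ θA) (hθB : ContDiff ℝ ∞ θB) (hθS : ContDiff ℝ ∞ θS)
    (hψA : ContDiff ℝ ∞ ψA) (hψB : ContDiff ℝ ∞ ψB) (hψS : ContDiff ℝ ∞ ψS) :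
    HasDerivAt (fun ε : ℝ => thermalEnergy ΩA ΩB κA κB κS
        (fun x => θA x + ε * ψA x) (fun x => θB x + ε * ψB x) (fun x => θS x + ε * ψS x))
      (-(∫ x in ΩA, κA x * ⟪gradient θA x, gradient ψA x⟫_ℝ)
        + -(∫ x in ΩB, κB x * ⟪gradient θB x, gradient ψB x⟫_ℝ)
        + -∫ x in frontier ΩA, κS x * ⟪surfGrad (outerNormal ΩA) θS x,
            surfGrad (outerNormal ΩA) ψS x⟫_ℝ ∂μHE[2]) 0 := by
  simp only [thermalEnergy, gradient_add_mul hθA hψA, gradient_add_mul hθB hψB,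
    surfGrad_add_mul hθS hψS]
  have c1 := continuous_gradient hθA
  have c2 := continuous_gradient hψA
  have c3 := continuous_gradient hθB
  have c4 := continuous_gradient hψB
  have c5 := hA.continuousOn_surfGrad hθS
  have c6 := hA.continuousOn_surfGrad hψS
  have c7 := hκS.continuousOn (s := frontier ΩA)
  refine ((hasDerivAt_integral_quadratic ?_ ?_ ?_).add
    (hasDerivAt_integral_quadratic ?_ ?_ ?_)).add (hasDerivAt_integral_quadratic ?_ ?_ ?_)
  · exact integrableOn_of_isBounded hA.isBounded (by fun_prop)
  · exact integrableOn_of_isBounded hA.isBounded (by fun_prop)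
  · exact integrableOn_of_isBounded hA.isBounded (by fun_prop)
  · exact integrableOn_of_isBounded hB (by fun_prop)
  · exact integrableOn_of_isBounded hB (by fun_prop)
  · exact integrableOn_of_isBounded hB (by fun_prop)
  · exact hA.integrableOn_frontier ((c7.div_const 2).neg.mul (c5.norm.pow 2))
  · exact hA.integrableOn_frontier (c7.mul (c5.inner c6))
  · exact hA.integrableOn_frontier ((c7.div_const 2).neg.mul (c6.norm.pow 2))

/-! ### Regularity of the tangential flux and its surface divergence. -/

/-- An extension of the tangential flux `κ ∇_Γ θ`. -/
def tangentialFlux (ρ κ θ : E3 → ℝ) (x : E3) : E3 :=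
  κ x • surfGrad (unitGradient ρ) θ x

namespace IsDefiningFunctionAt

variable {D : Set E3} {p : E3} {ρ κ θ : E3 → ℝ}

lemma contDiffAt_tangentialFlux (h : IsDefiningFunctionAt D p ρ) (hκ : ContDiff ℝ ∞ κ)
    (hθ : ContDiff ℝ ∞ θ) : ContDiffAt ℝ 2 (tangentialFlux ρ κ θ) p := by
  have hN := h.contDiffAt_unitGradient
  have hg := (contDiff_gradient hθ).contDiffAt (x := p)
  exact (hκ.contDiffAt.smul (hg.sub ((hN.inner ℝ hg).smul hN))).of_le
    (show (2 : WithTop ℕ∞) ≤ ∞ from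
          WithTop.coe_le_coe.mpr (le_top : (2 : ℕ∞) ≤ ⊤))

lemma tangentialFlux_eq (hD : IsOpen D) (hp : p ∈ frontier D) (h : IsDefiningFunctionAt D p ρ) :
    tangentialFlux ρ κ θ p = κ p • surfGrad (outerNormal D) θ p := by
  rw [tangentialFlux, surfGrad, surfGrad, tangentProj, tangentProj, outerNormal_eq hD hp h,
    unitGradient]

/-- The derivative within the surface sees only values on the surface, where the flux agrees near
`p` with the `C²` extension built from `ρ`. -/
lemma surfDiv_eq_tangentialDiv (hD : IsBoundedSmoothDomain D) (hp : p ∈ frontier D)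
    (h : IsDefiningFunctionAt D p ρ) (hκ : ContDiff ℝ ∞ κ) (hθ : ContDiff ℝ ∞ θ) :
    surfDiv (frontier D) (outerNormal D) (fun y => κ y • surfGrad (outerNormal D) θ y) p
      = tangentialDiv (outerNormal D p) (tangentialFlux ρ κ θ) p := by
  have hY := (h.contDiffAt_tangentialFlux hκ hθ).differentiableAt (by simp)
  rw [tangentialDiv, ← surfDiv_eq hD hp (fun x _ => rfl) hY, surfDiv, surfDiv]
  have heq : (fun y => κ y • surfGrad (outerNormal D) θ y) =ᶠ[𝓝[frontier D] p]
      tangentialFlux ρ κ θ := by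
    filter_upwards [mem_nhdsWithin_of_mem_nhds h.eventually, self_mem_nhdsWithin] with x h1 h2
    exact (tangentialFlux_eq hD.isOpen h2 h1).symm
  rw [heq.fderivWithin_eq (tangentialFlux_eq hD.isOpen hp h).symm]

end IsDefiningFunctionAt

/-- One defining function serves all boundary points near `p`, so the surface divergence is there an
expression in the continuous derivative of a single extension. -/
lemma IsBoundedSmoothDomain.continuousOn_surfDiv {D : Set E3} (hD : IsBoundedSmoothDomain D)
    {κ θ : E3 → ℝ} (hκ : ContDiff ℝ ∞ κ) (hθ : ContDiff ℝ ∞ θ) :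
    ContinuousOn (surfDiv (frontier D) (outerNormal D)
      (fun y => κ y • surfGrad (outerNormal D) θ y)) (frontier D) := by
  intro p hp
  obtain ⟨ρ, hρ⟩ := hD.smooth_boundary p hp
  have hY := hρ.contDiffAt_tangentialFlux hκ hθ
  have hfd : ContinuousAt (fderiv ℝ (tangentialFlux ρ κ θ)) p :=
    (hY.fderiv_right (m := 1) (by norm_num)).continuousAt
  have hn := hD.continuousOn_outerNormal p hp
  have hcoord (i : Fin 3) (w : E3 → E3) (hw : ContinuousWithinAt w (frontier D) p) :
      ContinuousWithinAt (fun x => (w x) i) (frontier D) p :=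
    (EuclideanSpace.proj i : E3 →L[ℝ] ℝ).continuous.continuousAt.comp_continuousWithinAt hw
  have hc : ContinuousWithinAt (fun x => tangentialDiv (outerNormal D x) (tangentialFlux ρ κ θ) x)
      (frontier D) p := by
    unfold tangentialDiv
    refine tendsto_finsetSum _ fun i _ => ?_
    exact (hcoord i _ (hfd.continuousWithinAt.clm_apply continuousWithinAt_const)).sub
      ((hcoord i _ hn).mul (hcoord i _ (hfd.continuousWithinAt.clm_apply hn)))
  refine hc.congr_of_eventuallyEq ?_ (hρ.surfDiv_eq_tangentialDiv hD hp hκ hθ)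
  filter_upwards [mem_nhdsWithin_of_mem_nhds hρ.eventually, self_mem_nhdsWithin] with x h1 h2
  exact h1.surfDiv_eq_tangentialDiv hD h2 hκ hθ

/-! ### Euler-Lagrange equations in the bulk and on the interface. -/

/-- The weak form of the thermal equations: the energy has the first variation `(QA, QB, QS)`. -/
def IsFirstVariation (Ω ΩA ΩB : Set E3) (κA κB κS θA θB θS QA QB QS : E3 → ℝ) : Prop :=
  ∀ ψA ψB ψS : E3 → ℝ, ContDiff ℝ ∞ ψA → ContDiff ℝ ∞ ψB → ContDiff ℝ ∞ ψS →
    ThermalBoundaryConditions Ω ΩA ψA ψB ψS →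
    -(∫ x in ΩA, κA x * ⟪gradient θA x, gradient ψA x⟫_ℝ)
        + -(∫ x in ΩB, κB x * ⟪gradient θB x, gradient ψB x⟫_ℝ)
        + -(∫ x in frontier ΩA, κS x * ⟪surfGrad (outerNormal ΩA) θS x,
            surfGrad (outerNormal ΩA) ψS x⟫_ℝ ∂μHE[2])
      = (∫ x in ΩA, QA x * ψA x) + (∫ x in ΩB, QB x * ψB x)
          + ∫ x in frontier ΩA, QS x * ψS x ∂μHE[2]

lemma gradient_eq_zero_of_notMem_tsupport {f : E3 → ℝ} {x : E3} (h : x ∉ tsupport f) :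
    gradient f x = 0 := by
  rw [gradient, fderiv_of_notMem_tsupport ℝ h, map_zero]

lemma gradient_zero_fun (x : E3) : gradient (fun _ : E3 => (0 : ℝ)) x = 0 := by
  simp [gradient]

lemma contDiff_flux {κ θ : E3 → ℝ} (hκ : ContDiff ℝ ∞ κ) (hθ : ContDiff ℝ ∞ θ) :
    ContDiff ℝ 1 fun y => κ y • gradient θ y :=
  (hκ.smul (contDiff_gradient hθ)).of_le (by simp)

lemma fderiv_flux {κ θ ψ : E3 → ℝ} (x : E3) :
    fderiv ℝ ψ x (κ x • gradient θ x) = κ x * ⟪gradient θ x, gradient ψ x⟫_ℝ := by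
  rw [map_smul, smul_eq_mul, real_inner_comm, inner_gradient_left]

namespace IsFirstVariation

variable {Ω ΩA ΩB : Set E3} {κA κB κS θA θB θS QA QB QS : E3 → ℝ}

/-- The variation `(ψ, 0, 0)` is admissible, because the support of `ψ` lies in the open set `ΩA`
and misses its boundary. -/
lemma eq_divergence_inner (h : IsFirstVariation Ω ΩA ΩB κA κB κS θA θB θS QA QB QS)
    (hA : IsOpen ΩA) (hκA : ContDiff ℝ ∞ κA) (hθA : ContDiff ℝ ∞ θA) (hQA : Continuous QA) :
    ∀ x ∈ ΩA, QA x = divergence (fun y => κA y • gradient θA y) x := by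
  refine eq_divergence_of_forall_integral hA (contDiff_flux hκA hθA) hQA fun ψ hψ hψc hψA => ?_
  have hbc : ThermalBoundaryConditions Ω ΩA ψ (fun _ => 0) (fun _ => 0) := by
    refine ⟨fun x _ => by simp [gradient_zero_fun], fun x hx => ⟨?_, rfl⟩⟩
    refine image_eq_zero_of_notMem_tsupport fun hxψ => ?_
    rw [hA.frontier_eq] at hx
    exact hx.2 (hψA hxψ)
  have := h ψ (fun _ => 0) (fun _ => 0) hψ contDiff_const contDiff_const hbc
  simpa [gradient_zero_fun, surfGrad, tangentProj, fderiv_flux] using this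

/-- The variation `(0, ψ, 0)` is admissible, because the support of `ψ` misses both `∂Ω` and `Γ`. -/
lemma eq_divergence_outer (h : IsFirstVariation Ω ΩA ΩB κA κB κS θA θB θS QA QB QS)
    (hΩ : IsOpen Ω) (hΩB : ΩB = Ω \ closure ΩA) (hκB : ContDiff ℝ ∞ κB) (hθB : ContDiff ℝ ∞ θB)
    (hQB : Continuous QB) :
    ∀ x ∈ ΩB, QB x = divergence (fun y => κB y • gradient θB y) x := by
  have hB : IsOpen ΩB := hΩB ▸ hΩ.sdiff isClosed_closure
  refine eq_divergence_of_forall_integral hB (contDiff_flux hκB hθB) hQB fun ψ hψ hψc hψB => ?_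
  have hbc : ThermalBoundaryConditions Ω ΩA (fun _ => 0) ψ (fun _ => 0) := by
    constructor
    · intro x hx
      rw [gradient_eq_zero_of_notMem_tsupport fun hxψ => ?_, inner_zero_right]
      rw [hΩ.frontier_eq] at hx
      have := hψB hxψ
      rw [hΩB] at this
      exact hx.2 this.1
    · intro x hx
      have : ψ x = 0 := image_eq_zero_of_notMem_tsupport fun hxψ => by
        have := hψB hxψ
        rw [hΩB] at this
        exact this.2 (frontier_subset_closure hx)
      exact ⟨this.symm, this⟩
  have := h (fun _ => 0) ψ (fun _ => 0) contDiff_const hψ contDiff_const hbc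
  simpa [gradient_zero_fun, surfGrad, tangentProj, fderiv_flux] using this

/-- The equation on the interface. -/
lemma eq_surfDiv (h : IsFirstVariation Ω ΩA ΩB κA κB κS θA θB θS QA QB QS)
    (hΩ : IsOpen Ω) (hA : IsBoundedSmoothDomain ΩA) (hAΩ : closure ΩA ⊆ Ω)
    (hΩB : ΩB = Ω \ closure ΩA) (hκA : ContDiff ℝ ∞ κA) (hκB : ContDiff ℝ ∞ κB)
    (hκS : ContDiff ℝ ∞ κS) (hθA : ContDiff ℝ ∞ θA) (hθB : ContDiff ℝ ∞ θB)
    (hθS : ContDiff ℝ ∞ θS) (hQA : Continuous QA) (hQB : Continuous QB) (hQS : Continuous QS) :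
    ∀ x ∈ frontier ΩA,
      QS x = surfDiv (frontier ΩA) (outerNormal ΩA)
          (fun y => κS y • surfGrad (outerNormal ΩA) θS y) x
        + κB x * ⟪outerNormal ΩA x, gradient θB x⟫_ℝ
        - κA x * ⟪outerNormal ΩA x, gradient θA x⟫_ℝ := by
  intro p hp
  set Γ := frontier ΩA with hΓ
  set n := outerNormal ΩA with hn
  set σ := surfDiv Γ n fun y => κS y • surfGrad n θS y with hσ
  set YA : E3 → E3 := fun y => κA y • gradient θA y with hYA
  set YB : E3 → E3 := fun y => κB y • gradient θB y with hYB
  have hΓm : MeasurableSet Γ := isClosed_frontier.measurableSet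
  have hYAc : ContDiff ℝ 1 YA := contDiff_flux hκA hθA
  have hYBc : ContDiff ℝ 1 YB := contDiff_flux hκB hθB
  have hnc : ContinuousOn n Γ := hA.continuousOn_outerNormal
  have hσc : ContinuousOn σ Γ := hA.continuousOn_surfDiv hκS hθS
  have hBb : IsOpen ΩB := hΩB ▸ hΩ.sdiff isClosed_closure
  have hnAc : ContinuousOn (fun x => ⟪n x, YA x⟫_ℝ) Γ := hnc.inner hYAc.continuous.continuousOn
  have hnBc : ContinuousOn (fun x => ⟪n x, YB x⟫_ℝ) Γ := hnc.inner hYBc.continuous.continuousOn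
  -- `R` is the residual of the interface equation; the goal is `R p = 0`.
  set R : E3 → ℝ := fun x => QS x - σ x - ⟪n x, YB x⟫_ℝ + ⟪n x, YA x⟫_ℝ with hR
  have hRc : ContinuousOn R Γ := ((hQS.continuousOn.sub hσc).sub hnBc).add hnAc
  obtain ⟨ρ, hρ⟩ := hA.smooth_boundary p hp
  obtain ⟨U₀, hU₀, hdiv₀⟩ := exists_setIntegral_fderiv_eq hA.isOpen hp hρ
  -- On `U` the divergence theorem holds, `ρ` defines `ΩA` at every point, and `∂Ω` is avoided. The
  -- last point makes the Neumann condition trivial for test functions supported in `U` and keeps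
  -- `∂Ω` out of the divergence theorem in `ΩB`.
  obtain ⟨U, hUsub, hUo, hpU⟩ := mem_nhds_iff.mp (inter_mem (inter_mem hU₀ hρ.eventually)
    (hΩ.mem_nhds (hAΩ (frontier_subset_closure hp))))
  have hdiv : ∀ f : E3 → ℝ, ContDiff ℝ 1 f → HasCompactSupport f → tsupport f ⊆ U → ∀ v : E3,
      ∫ x in ΩA, fderiv ℝ f x v = ∫ x in Γ, f x * ⟪n x, v⟫_ℝ ∂μHE[2] :=
    fun f hf hfc hfU => hdiv₀ f hf hfc fun x hx => (hUsub (hfU hx)).1.1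
  have hdivB : ∀ f : E3 → ℝ, ContDiff ℝ 1 f → HasCompactSupport f → tsupport f ⊆ U → ∀ v : E3,
      ∫ x in ΩB, fderiv ℝ f x v = ∫ x in Γ, f x * ⟪-n x, v⟫_ℝ ∂μHE[2] := by
    intro f hf hfc hfU v
    rw [hΩB, setIntegral_exterior_fderiv hΩ hA hf hfc (fun x hx => (hUsub (hfU hx)).2),
      hdiv f hf hfc hfU, ← integral_neg]
    simp only [inner_neg_left, mul_neg]
  have hρU : ∀ x ∈ U, IsDefiningFunctionAt ΩA x ρ := fun x hx => (hUsub hx).1.2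
  have hnint : ∀ f : E3 → ℝ, Continuous f → ∀ v,
      IntegrableOn (fun x => f x * ⟪n x, v⟫_ℝ) Γ μHE[2] := fun f hf v =>
    hA.integrableOn_frontier (hf.continuousOn.mul (hnc.inner continuousOn_const))
  have htest : ∀ ψ : E3 → ℝ, ContDiff ℝ ∞ ψ → HasCompactSupport ψ → tsupport ψ ⊆ U →
      ∫ x in Γ, ψ x • R x ∂μHE[2] = 0 := by
    intro ψ hψ hψc hψU
    have hψ1 : ContDiff ℝ 1 ψ := hψ.of_le (by simp)
    have hψ2 : ContDiff ℝ 2 ψ := hψ.of_le (show (2 : WithTop ℕ∞) ≤ ∞ from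
      WithTop.coe_le_coe.mpr (le_top : (2 : ℕ∞) ≤ ⊤))
    have hψi (f : E3 → ℝ) (hf : Continuous f) : Integrable fun x => ψ x * f x :=
      (hψ.continuous.mul hf).integrable_of_hasCompactSupport hψc.mul_right
    have hψd (Y : E3 → E3) (hY : Continuous Y) : Integrable fun x => fderiv ℝ ψ x (Y x) := by
      refine ((hψ1.continuous_fderiv (by simp)).clm_apply hY).integrable_of_hasCompactSupport ?_
      exact (hψc.fderiv ℝ).mono fun x hx h0 => hx (by simp [h0])
    have hweak := h ψ ψ ψ hψ hψ hψ ⟨fun x hx => by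
      rw [gradient_eq_zero_of_notMem_tsupport fun hxψ => ?_, inner_zero_right]
      rw [hΩ.frontier_eq] at hx
      exact hx.2 (hUsub (hψU hxψ)).2, fun x _ => ⟨rfl, rfl⟩⟩
    have eA := integral_divergence_smul (μ := volume.restrict ΩA) (ν := μHE[2].restrict Γ)
      hnint hdiv hψ1 hψc hψU hYAc
    have eB := integral_divergence_smul (μ := volume.restrict ΩB) (ν := μHE[2].restrict Γ)
      (n := fun x => -n x) (fun f hf v => by
        simp only [inner_neg_left, mul_neg]
        exact (hnint f hf v).neg) hdivB hψ1 hψc hψU hYBc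
    have eS := setIntegral_mul_tangentialDiv_add hA hdiv hρU
      (Y := tangentialFlux ρ κS θS) (fun x hx => (hρU x hx).contDiffAt_tangentialFlux hκS hθS)
      (fun x hx => by
        rw [IsDefiningFunctionAt.tangentialFlux_eq hA.isOpen hx.1 (hρU x hx.2),
          real_inner_smul_right, surfGrad, inner_tangentProj_left (hA.norm_outerNormal hx.1),
          mul_zero]) hψ2 hψc hψU
    rw [integral_add (hψi _ (divergence_continuous hYAc)).integrableOn
      (hψd _ hYAc.continuous).integrableOn] at eA
    rw [integral_add (hψi _ (divergence_continuous hYBc)).integrableOn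
      (hψd _ hYBc.continuous).integrableOn] at eB
    -- The bulk equations turn the divergence terms into the integrals of `QA ψ` and `QB ψ` in the
    -- weak form, so that only integrals over `Γ` survive.
    have gA : ∫ x in ΩA, ψ x * divergence YA x = ∫ x in ΩA, QA x * ψ x :=
      setIntegral_congr_fun hA.isOpen.measurableSet fun x hx => by
        rw [h.eq_divergence_inner hA.isOpen hκA hθA hQA x hx, mul_comm]
    have gB : ∫ x in ΩB, ψ x * divergence YB x = ∫ x in ΩB, QB x * ψ x :=
      setIntegral_congr_fun hBb.measurableSet fun x hx => by
        rw [h.eq_divergence_outer hΩ hΩB hκB hθB hQB x hx, mul_comm]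
    have gS : ∫ x in Γ, (ψ x * tangentialDiv (n x) (tangentialFlux ρ κS θS) x
          + fderiv ℝ ψ x (tangentialFlux ρ κS θS x)) ∂μHE[2]
        = ∫ x in Γ, (ψ x * σ x + κS x * ⟪surfGrad n θS x, surfGrad n ψ x⟫_ℝ) ∂μHE[2] := by
      refine setIntegral_congr_fun hΓm fun x hx => ?_
      by_cases hxψ : x ∈ tsupport ψ
      · have hdef := hρU x (hψU hxψ)
        change _ = ψ x * surfDiv Γ n _ x + _
        rw [hdef.surfDiv_eq_tangentialDiv hA hx hκS hθS]
        rw [hdef.tangentialFlux_eq hA.isOpen hx, map_smul, smul_eq_mul, surfGrad, surfGrad,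
          inner_tangentProj_tangentProj (hA.norm_outerNormal hx), real_inner_comm,
          inner_gradient_left]
      · simp [fderiv_of_notMem_tsupport ℝ hxψ, image_eq_zero_of_notMem_tsupport hxψ, surfGrad,
          tangentProj, gradient_eq_zero_of_notMem_tsupport hxψ]
    have i1 : IntegrableOn (fun x => ψ x * σ x) Γ μHE[2] :=
      hA.integrableOn_frontier (hψ.continuous.continuousOn.mul hσc)
    have i2 : IntegrableOn (fun x => κS x * ⟪surfGrad n θS x, surfGrad n ψ x⟫_ℝ) Γ μHE[2] :=
      hA.integrableOn_frontier (hκS.continuous.continuousOn.mul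
        ((hA.continuousOn_surfGrad hθS).inner (hA.continuousOn_surfGrad hψ)))
    have i3 : IntegrableOn (fun x => QS x * ψ x) Γ μHE[2] :=
      hA.integrableOn_frontier (hQS.mul hψ.continuous).continuousOn
    have i4 : IntegrableOn (fun x => ψ x * ⟪n x, YA x⟫_ℝ) Γ μHE[2] :=
      hA.integrableOn_frontier (hψ.continuous.continuousOn.mul hnAc)
    have i5 : IntegrableOn (fun x => ψ x * ⟪-n x, YB x⟫_ℝ) Γ μHE[2] := by
      simp only [inner_neg_left, mul_neg]
      exact (hA.integrableOn_frontier (hψ.continuous.continuousOn.mul hnBc)).neg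
    rw [gS, integral_add i1 i2] at eS
    rw [gA] at eA
    rw [gB] at eB
    simp only [hYA, hYB, fderiv_flux] at eA eB
    have hsplit : ∫ x in Γ, ψ x • R x ∂μHE[2] = (∫ x in Γ, QS x * ψ x ∂μHE[2])
        - (∫ x in Γ, ψ x * σ x ∂μHE[2]) + (∫ x in Γ, ψ x * ⟪-n x, YB x⟫_ℝ ∂μHE[2])
        + ∫ x in Γ, ψ x * ⟪n x, YA x⟫_ℝ ∂μHE[2] := by
      have j1 : IntegrableOn (fun x => QS x * ψ x - ψ x * σ x) Γ μHE[2] := i3.sub i1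
      have j2 : IntegrableOn (fun x => QS x * ψ x - ψ x * σ x + ψ x * ⟪-n x, YB x⟫_ℝ) Γ μHE[2] :=
        j1.add i5
      rw [← integral_sub i3 i1, ← integral_add j1 i5, ← integral_add j2 i4]
      congr 1 with x
      simp only [hR, smul_eq_mul, inner_neg_left]
      ring
    rw [hsplit]
    linarith
  have hae := hUo.ae_eq_zero_of_integral_contDiff_smul_eq_zero (μ := μHE[2].restrict Γ) (f := R)
    ((hA.integrableOn_frontier hRc).integrable.locallyIntegrable.locallyIntegrableOn U) htest
  -- `R` is continuous only along `Γ`. If `R p ≠ 0`, it would be nonzero on a relative neighbourhood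
  -- of `p` in `Γ`, which has positive area.
  have hRp : R p = 0 := by
    by_contra hne
    have hev : ∀ᶠ x in 𝓝[Γ] p, R x ≠ 0 := (hRc p hp).eventually_ne hne
    rw [eventually_nhdsWithin_iff] at hev
    have hpos := euclideanHausdorffMeasure_frontier_inter_pos hA.isOpen hp hρ
      (inter_mem hev (hUo.mem_nhds hpU))
    rw [ae_restrict_iff' hΓm, ae_iff] at hae
    refine hpos.ne' (measure_mono_null (fun x hx => ?_) hae)
    simp only [mem_ofPred_eq, not_forall]
    exact ⟨hx.1, hx.2.2, hx.2.1 hx.1⟩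
  simp only [hR, hYA, hYB, real_inner_smul_right] at hRp
  linarith

end IsFirstVariation

end ThermalDiffusion

end

theorem theorem2p7
    (T t : ℝ) (ht : 0 < t) (htT : t < T)
    -- the container, and the moving domain whose moving boundary is the interface
    (Ω : Set E3) (hΩ : IsBoundedSmoothDomain Ω)
    (ΩA : ℝ → Set E3) (hΩA : ∀ s ∈ Ico 0 T, IsBoundedSmoothDomain (ΩA s))
    (hΩAΩ : ∀ s ∈ Ico 0 T, closure (ΩA s) ⊆ Ω)
    (ΩB : ℝ → Set E3) (hΩB : ∀ s, ΩB s = Ω \ closure (ΩA s))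
    -- the temperatures and the thermal conductivities are smooth in space and time
    (θA θB θS κA κB κS : E3 → ℝ → ℝ)
    (hθA : ContDiff ℝ ∞ (fun p : E3 × ℝ => θA p.1 p.2))
    (hθB : ContDiff ℝ ∞ (fun p : E3 × ℝ => θB p.1 p.2))
    (hθS : ContDiff ℝ ∞ (fun p : E3 × ℝ => θS p.1 p.2))
    (hκA : ContDiff ℝ ∞ (fun p : E3 × ℝ => κA p.1 p.2))
    (hκB : ContDiff ℝ ∞ (fun p : E3 × ℝ => κB p.1 p.2))
    (hκS : ContDiff ℝ ∞ (fun p : E3 × ℝ => κS p.1 p.2))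
    (hθ : ∀ s ∈ Ioo 0 T, ThermalBoundaryConditions Ω (ΩA s)
      (fun x => θA x s) (fun x => θB x s) (fun x => θS x s))
    (QA QB QS : E3 → ℝ) (hQA : Continuous QA) (hQB : Continuous QB) (hQS : Continuous QS)
    -- the first variation of the energy at time `t`
    (hvar : ∀ ψA ψB ψS : E3 → ℝ, ContDiff ℝ ∞ ψA → ContDiff ℝ ∞ ψB → ContDiff ℝ ∞ ψS →
      ThermalBoundaryConditions Ω (ΩA t) ψA ψB ψS →
      HasDerivAt
        (fun ε : ℝ => thermalEnergy (ΩA t) (ΩB t)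
          (fun x => κA x t) (fun x => κB x t) (fun x => κS x t)
          (fun x => θA x t + ε * ψA x) (fun x => θB x t + ε * ψB x)
          (fun x => θS x t + ε * ψS x))
        ((∫ x in ΩA t, QA x * ψA x) + (∫ x in ΩB t, QB x * ψB x)
          + ∫ x in frontier (ΩA t), QS x * ψS x ∂μHE[2])
        0) :
    (∀ x ∈ ΩA t, QA x = divergence (fun y => κA y t • gradient (fun z => θA z t) y) x) ∧
    (∀ x ∈ ΩB t, QB x = divergence (fun y => κB y t • gradient (fun z => θB z t) y) x) ∧
    (∀ x ∈ frontier (ΩA t),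
      QS x = surfDiv (frontier (ΩA t)) (outerNormal (ΩA t))
          (fun y => κS y t • surfGrad (outerNormal (ΩA t)) (fun z => θS z t) y) x
        + κB x t * ⟪outerNormal (ΩA t) x, gradient (fun z => θB z t) x⟫_ℝ
        - κA x t * ⟪outerNormal (ΩA t) x, gradient (fun z => θA z t) x⟫_ℝ) := by
  have htI : t ∈ Ico 0 T := ⟨ht.le, htT⟩
  have slice {f : E3 → ℝ → ℝ} (hf : ContDiff ℝ ∞ (fun p : E3 × ℝ => f p.1 p.2)) :
      ContDiff ℝ ∞ fun x => f x t :=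
    hf.comp (contDiff_id.prodMk contDiff_const)
  have hB : Bornology.IsBounded (ΩB t) := by
    rw [hΩB]; exact hΩ.isBounded.subset sdiff_subset
  -- The computed and the prescribed derivative belong to the same function of `ε`, so uniqueness of
  -- derivatives gives the weak form at time `t`.
  have h : IsFirstVariation Ω (ΩA t) (ΩB t) (fun x => κA x t) (fun x => κB x t) (fun x => κS x t)
      (fun x => θA x t) (fun x => θB x t) (fun x => θS x t) QA QB QS :=
    fun ψA ψB ψS hψA hψB hψS hbc =>
      (hasDerivAt_thermalEnergy (hΩA t htI) hB (slice hκA).continuous (slice hκB).continuous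
        (slice hκS).continuous (slice hθA) (slice hθB) (slice hθS) hψA hψB hψS).unique
        (hvar ψA ψB ψS hψA hψB hψS hbc)
  exact ⟨h.eq_divergence_inner (hΩA t htI).isOpen (slice hκA) (slice hθA) hQA,
    h.eq_divergence_outer hΩ.isOpen (hΩB t) (slice hκB) (slice hθB) hQB,
    h.eq_surfDiv hΩ.isOpen (hΩA t htI) (hΩAΩ t htI) (hΩB t) (slice hκA) (slice hκB) (slice hκS)
      (slice hθA) (slice hθB) (slice hθS) hQA hQB hQS⟩
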